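/- **Conventions.** All sets of possible worlds and all carriers of first-order structures are non-empty. A first-order signature $(F,P)=((F_n)_n,(P_n)_n)$ consists of function and predicate symbols of each finite arity (one sort, no equality); homomorphisms of first-order structures commute with the functions and preserve the predicates. The following logics are stratified institutions: each signature $\Sigma$ has a set $\mathrm{Sen}(\Sigma)$ of sentences and a category $\mathrm{Mod}(\Sigma)$ of models; each model $M$ has a set $[\![M]\!]$ of states, functorially in $M$; satisfaction $M\models^w\rho$ depends on a state $w\in[\![M]\!]$; signature morphisms act by renaming symbols in sentences and by reducts on models, and $[\![M']\!]\to[\![M]\!]$ is given for each reduct $M$ of $M'$, so that satisfaction is invariant under change of notation. *Kripke logics.* A frame $W=(|W|,(W_i)_{i\in\mathrm{Nom}},(W_\lambda)_{\lambda\in\Lambda})$ has a set $|W|$ of worlds, elements $W_i\in|W|$ and relations $W_\lambda\subseteq|W|^n$ for $\lambda\in\Lambda_n$; the states of a model $(W,M)$ are the worlds. * $\mathrm{MHPL}$: signatures $(\mathrm{Nom},\Lambda,P)$; sentences $S::=p\mid S\wedge S\mid\neg S\mid\langle\lambda\rangle(S,\dots,S)\mid i\text{-sen}\mid @_iS\mid(\exists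 i)S'$, where $p\in P$, $\lambda\in\Lambda_{n+1}$ is applied to $n$ arguments, $i\in\mathrm{Nom}$, and in $(\exists i)S'$ the nominal $i$ is new and $S'$ is a sentence of the signature extended by $i$. A model is a frame $W$ with a map $M:|W|\to 2^P$; homomorphisms are maps of worlds preserving nominals, relations, and truth of the $p\in P$. Satisfaction: $\models^w p$ iff $p\in M^w$; Boolean connectives as usual; $\models^w\langle\lambda\rangle(\rho_1,\dots,\rho_n)$ iff there is $(w,w_1,\dots,w_n)\in W_\lambda$ with $\models^{w_k}\rho_k$ for all $k$; $\models^w i\text{-sen}$ iff $W_i=w$; $\models^w@_i\rho$ iff $\models^{W_i}\rho$; $\models^w(\exists i)\rho$ iff $\models^w\rho$ for some interpretation of $i$. * $\mathrm{MHFOL}$: signatures $(\mathrm{Nom},\Lambda,(F,P))$; the same, with atoms $\pi(t_1,\dots,t_n)$ (evaluated in the structure $M^w$) in place of $p$, and with quantification $(\exists x)S'$ over a new constant $x$. A model is a frame with $(F,P)$-structures $M^w$ ($w\in|W|$) which all have the same carrier and the same interpretations of constants; $(\exists x)$ ranges over the common carrier; a homomorphism is a frame homomorphism $h_0$ with a map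 $h_1$ of carriers that is a homomorphism $M^w\to N^{h_0(w)}$ for all $w$. * $\mathrm{MMPL},\mathrm{MMFOL}$ omit from these the nominals and all hybrid constructs ($i$-sen, $@_i$, $(\exists i)$); $\mathrm{HPL},\mathrm{HFOL}$ have, instead of $\Lambda$, one binary relation with $\Diamond=\langle\lambda\rangle$; $\mathrm{MPL},\mathrm{MFOL}$ do both. * $\mathrm{HHPL}$: signatures $(\mathrm{Nom}^0,\mathrm{Nom}^1,P)$; the sentences are built from $\mathrm{HPL}$-sentences over $(\mathrm{Nom}^0,P)$, as atoms, and $i$-sen ($i\in\mathrm{Nom}^1$) by upper-layer $\wedge,\neg,\Diamond,@_i$ ($i\in\mathrm{Nom}^1$) and $\exists$ over new nominals of either layer. A model is a frame $W^1$ (with nominals $\mathrm{Nom}^1$, one binary relation) with an $\mathrm{HPL}$-model $M^w$ over $(\mathrm{Nom}^0,P)$ for each $w\in|W^1|$, all of these having the same worlds and the same interpretations of the nominals; the states are the $w\in|W^1|$, and an atom $\rho$ holds at $w$ iff $\rho$ holds at all worlds of $M^w$. Homomorphisms are pairs as for $\mathrm{MHFOL}$. *Open first-order logics.* Signatures are $((F,P),X)$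 with $X$ a finite set of variables; models are $(F,P)$-structures $M$; states are the valuations $w\in|M|^X$. $\mathrm{OFOL}$: the sentences are the first-order sentences over $(F\cup X,P)$ built from atoms by $\wedge,\neg,(\exists x)$ (with $x$ a new constant), and $M\models^w\rho$ iff $\rho$ holds in $M$ with $X$ interpreted by $w$. $\mathrm{MOFOL}$ adds $\langle\pi\rangle(S,\dots,S)$ for $\pi\in P_{n+1}$, with $\models^w\langle\pi\rangle(\rho_1,\dots,\rho_n)$ iff there is $(w,w_1,\dots,w_n)\in(M^X)_\pi$ with $\models^{w_k}\rho_k$ for all $k$, where $M^X$ is the power of $M$. $\mathrm{HOFOL}$ adds to $\mathrm{OFOL}$ the sentences $i$-sen, $@_iS$ and $(\exists i)S'$ for constants $i$, read through the interpretation $(M^X)_i\in|M|^X$, the constant valuation with value $M_i$. $\mathrm{HMOFOL}$ has both. Signature morphisms $(\Sigma,X)\to(\Sigma',X')$ are first-order signature morphisms $\Sigma\to\Sigma'$, where $X\subseteq X'$ is required in $\mathrm{OFOL}$ and $X=X'$ in the other three. **Ultraproducts.** For an ultrafilter $U$ on a set $A$ and $\Sigma$-models $(M_a)_{a\in A}$,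 an ultraproduct is a colimit $(\mu_J:M_J\to M_U)_{J\in U}$ in $\mathrm{Mod}(\Sigma)$ of the directed diagram of canonical projections $M_J\to M_{J'}$ ($J\supseteq J'$ in $U$), where $(p_{J,a}:M_J\to M_a)_{a\in J}$ is a direct product. Consider, for a sentence $\rho$ and $w\in[\![M_U]\!]$, the condition (∗) there are $J\in U$ and $k\in[\![M_J]\!]$ with $[\![\mu_J]\!](k)=w$ and $M_a\models^{[\![p_{J,a}]\!](k)}\rho$ for all $a\in J$. The sentence $\rho$ is *preserved by ultraproducts* if (∗) implies $M_U\models^w\rho$, and *preserved by ultrafactors* if $M_U\models^w\rho$ implies (∗), for all $U$, all families, all their ultraproducts and all $w$. **Compactness.** $\mathcal I^\sharp$ (the local institution) has as models the pairs $(M,w)$ with $w\in[\![M]\!]$, and $(M,w)\models\rho$ iff $M\models^w\rho$. $\mathcal I^*$ (the global institution, defined if all the maps $[\![M']\!]\to[\![M]\!]$ for reducts are surjective) has the models of $\mathcal I$, and $M\models\rho$ iff $M\models^w\rho$ for all $w\in[\![M]\!]$. An institution is *m-compact* if, over each signature, a set $E$ of sentences has a model iff each finite subset of $E$ has a model; it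 is *compact* if, whenever $E\models\rho$, already $E_0\models\rho$ for some finite $E_0\subseteq E$. **Theorem.** Let $\mathcal I$ be any of $\mathrm{MPL}$, $\mathrm{MFOL}$, $\mathrm{HPL}$, $\mathrm{HFOL}$, $\mathrm{MMPL}$, $\mathrm{MHPL}$, $\mathrm{MMFOL}$, $\mathrm{MHFOL}$, $\mathrm{HHPL}$, $\mathrm{OFOL}$, $\mathrm{MOFOL}$, $\mathrm{HOFOL}$, $\mathrm{HMOFOL}$. Then all ultraproducts of models exist, and every sentence of $\mathcal I$ is preserved by all ultraproducts and by all ultrafactors. Moreover $\mathcal I^\sharp$ is m-compact and compact, the maps $[\![M']\!]\to[\![M]\!]$ are surjective (so that $\mathcal I^*$ is defined), and $\mathcal I^*$ is m-compact. -/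

import Mathlib

universe u
open CategoryTheory Opposite FirstOrder

namespace Strat

/-! ## Institutions and compactness -/

structure Institution : Type (u + 2) where
  Sign : Type (u + 1)
  [cat : Category.{u} Sign]
  Sen : Sign ⥤ Type u
  Mod : Signᵒᵖ ⥤ Cat.{u, u + 1}
  Sat {S : Sign} : Mod.obj (op S) → Sen.obj S → Prop
  sat_cond {S T : Sign} (φ : S ⟶ T) (M : Mod.obj (op T)) (ρ : Sen.obj S) :
    Sat M (Sen.map φ ρ) ↔ Sat ((Mod.map φ.op).toFunctor.obj M) ρ

attribute [instance] Institution.cat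

namespace Institution

variable (I : Institution.{u})

/-- The class `E^*` of the models of a set `E` of `S`-sentences. -/
def models {S : I.Sign} (E : Set (I.Sen.obj S)) : Set (I.Mod.obj (op S)) :=
  {M | ∀ ρ ∈ E, I.Sat M ρ}

def MCompact : Prop :=
  ∀ (S : I.Sign) (E : Set (I.Sen.obj S)),
    (I.models E).Nonempty ↔ ∀ E₀ ⊆ E, E₀.Finite → (I.models E₀).Nonempty

def Compact : Prop :=
  ∀ (S : I.Sign) (E : Set (I.Sen.obj S)) (ρ : I.Sen.obj S),
    I.models E ⊆ I.models {ρ} → ∃ E₀ ⊆ E, E₀.Finite ∧ I.models E₀ ⊆ I.models {ρ}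

end Institution

/-! ## Stratified institutions -/

/-- A stratified institution. `st S M` is the set of states of the `S`-model `M`, and
`stMap φ` is the component at `φ` of the lax natural transformation from `Mod` to the functor
constantly equal to the category of sets; `stMap_id` and `stMap_comp` are its coherence laws
(heterogeneous equalities, since reducts compose only up to a propositional equality). -/
structure StratInst : Type (u + 2) where
  Sign : Type (u + 1)
  [cat : Category.{u} Sign]
  Sen : Sign ⥤ Type u
  Mod : Signᵒᵖ ⥤ Cat.{u, u + 1}
  st (S : Sign) : Mod.obj (op S) ⥤ Type u
  stMap {S T : Sign} (φ : S ⟶ T) : st T ⟶ (Mod.map φ.op).toFunctor ⋙ st S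
  stMap_id (S : Sign) (M : Mod.obj (op S)) (w : (st S).obj M) :
    HEq ((stMap (𝟙 S)).app M w) w
  stMap_comp {S T R : Sign} (φ : S ⟶ T) (ψ : T ⟶ R) (M : Mod.obj (op R)) (w : (st R).obj M) :
    HEq ((stMap (φ ≫ ψ)).app M w) ((stMap φ).app _ ((stMap ψ).app M w))
  Sat {S : Sign} (M : Mod.obj (op S)) (w : (st S).obj M) (ρ : Sen.obj S) : Prop
  sat_cond {S T : Sign} (φ : S ⟶ T) (M : Mod.obj (op T)) (w : (st T).obj M) (ρ : Sen.obj S) :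
    Sat ((Mod.map φ.op).toFunctor.obj M) ((stMap φ).app M w) ρ ↔ Sat M w (Sen.map φ ρ)

attribute [instance] StratInst.cat

/-! ## Filtered products -/

/-- A choice, for each `J ∈ F`, of a direct product of the family `(M i)` with `i ∈ J`. -/
structure ProductSystem {C : Type (u + 1)} [Category.{u} C] {ι : Type u} (F : Filter ι)
    (M : ι → C) where
  prod (J : {J : Set ι // J ∈ F}) : C
  proj (J : {J : Set ι // J ∈ F}) (i : J.1) : prod J ⟶ M i
  isProd (J : {J : Set ι // J ∈ F}) : Limits.IsLimit (Limits.Fan.mk (prod J) (proj J))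

/-- The directed diagram of the canonical projections between the products over `J ∈ F`. -/
def ProductSystem.diagram {C : Type (u + 1)} [Category.{u} C] {ι : Type u} {F : Filter ι}
    {M : ι → C} (A : ProductSystem F M) : {J : Set ι // J ∈ F}ᵒᵖ ⥤ C where
  obj J := A.prod J.unop
  map {_ J'} f := Limits.Fan.IsLimit.lift (A.isProd J'.unop)
    fun i => A.proj _ ⟨i.1, leOfHom f.unop i.2⟩
  map_id J := Limits.Fan.IsLimit.hom_ext (A.isProd J.unop) _ _ fun i => by
    rw [Limits.Fan.IsLimit.fac, Category.id_comp]; rfl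
  map_comp {J J' J''} f g := Limits.Fan.IsLimit.hom_ext (A.isProd J''.unop) _ _ fun i => by
    rw [Limits.Fan.IsLimit.fac, Category.assoc, Limits.Fan.IsLimit.fac]
    exact (Limits.Fan.IsLimit.fac (A.isProd J'.unop)
      (fun i => A.proj J.unop ⟨i.1, leOfHom f.unop i.2⟩) ⟨i.1, leOfHom g.unop i.2⟩).symm

/-- An `F`-product of the family `M`: a colimit of the diagram of projections. -/
structure FilteredProduct {C : Type (u + 1)} [Category.{u} C] {ι : Type u} (F : Filter ι)
    (M : ι → C) extends ProductSystem F M where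
  cocone : Limits.Cocone toProductSystem.diagram
  isColimit : Limits.IsColimit cocone

namespace StratInst

variable (I : StratInst.{u})

/-- The reduct functor of the local institution. -/
def sharpRed {S T : I.Sign} (φ : S ⟶ T) : (I.st T).Elements ⥤ (I.st S).Elements where
  obj p := ⟨(I.Mod.map φ.op).toFunctor.obj p.1, (I.stMap φ).app p.1 p.2⟩
  map {p q} f := ⟨(I.Mod.map φ.op).toFunctor.map f.1, by
    have := NatTrans.naturality_apply (I.stMap φ) f.1 p.2
    rw [f.2] at this
    exact this.symm⟩

theorem elements_functor_ext {S : I.Sign} {C : Type (u+1)} [Category.{u} C]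
    (F G : C ⥤ (I.st S).Elements) (A B : C ⥤ I.Mod.obj (op S)) (hAB : A = B)
    (hF : ∀ c, (F.obj c).1 = A.obj c) (hG : ∀ c, (G.obj c).1 = B.obj c)
    (hFm : ∀ {c d} (f : c ⟶ d), HEq (F.map f).1 (A.map f))
    (hGm : ∀ {c d} (f : c ⟶ d), HEq (G.map f).1 (B.map f))
    (h2 : ∀ c, HEq (F.obj c).2 (G.obj c).2) : F = G := by
  subst hAB
  have h1 : ∀ c, F.obj c = G.obj c := fun c =>
    Sigma.ext ((hF c).trans (hG c).symm) (h2 c)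
  refine Functor.hext h1 fun c d f => ?_
  have key : ∀ (p p' q q' : (I.st S).Elements) (hp : p = p') (hq : q = q') (a : p ⟶ q)
      (b : p' ⟶ q'), HEq a.1 b.1 → HEq a b := by
    rintro p _ q _ rfl rfl a b h
    exact heq_of_eq (Subtype.ext (eq_of_heq h))
  exact key _ _ _ _ (h1 c) (h1 d) _ _ ((hFm f).trans (hGm f).symm)

/-- The local institution: its models are the pairs `(M, w)` with `w` a state of `M`, i.e. the
objects of the category of elements of the state functor. -/
def sharp : Institution.{u} where
  Sign := I.Sign
  Sen := I.Sen
  Mod :=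
    { obj := fun S => Cat.of (I.st S.unop).Elements
      map := fun φ => (I.sharpRed φ.unop).toCatHom
      map_id := fun S => by
        apply Cat.ext
        refine I.elements_functor_ext _ _ (CategoryOfElements.π _ ⋙ (I.Mod.map (𝟙 S)).toFunctor)
          (CategoryOfElements.π _) ?_ (fun _ => rfl) (fun _ => rfl) (fun _ => HEq.rfl)
          (fun _ => HEq.rfl) (fun p => I.stMap_id _ p.1 p.2)
        rw [I.Mod.map_id]; rfl
      map_comp := fun {R S T} φ ψ => by
        apply Cat.ext
        refine I.elements_functor_ext _ _ (CategoryOfElements.π _ ⋙ (I.Mod.map (φ ≫ ψ)).toFunctor)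
          (CategoryOfElements.π _ ⋙ (I.Mod.map φ).toFunctor ⋙ (I.Mod.map ψ).toFunctor) ?_
          (fun _ => rfl) (fun _ => rfl) (fun _ => HEq.rfl)
          (fun _ => HEq.rfl) (fun p => I.stMap_comp _ _ p.1 p.2)
        rw [I.Mod.map_comp]; rfl }
  Sat p ρ := I.Sat p.1 p.2 ρ
  sat_cond φ p ρ := (I.sat_cond φ p.1 p.2 ρ).symm

/-- The stratification is surjective. -/
def StSurjective : Prop :=
  ∀ {S T : I.Sign} (φ : S ⟶ T) (M : I.Mod.obj (op T)),
    Function.Surjective ((I.stMap φ).app M)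

/-- The global institution. -/
def star (h : I.StSurjective) : Institution.{u} where
  Sign := I.Sign
  Sen := I.Sen
  Mod := I.Mod
  Sat {S} M ρ := ∀ w : (I.st S).obj M, I.Sat M w ρ
  sat_cond {S T} φ M ρ := by
    constructor
    · intro H w
      obtain ⟨w, rfl⟩ := h φ M w
      exact (I.sat_cond φ M w ρ).2 (H w)
    · intro H w
      exact (I.sat_cond φ M w ρ).1 (H _)

/-- Restriction of a stratified institution along a functor into its category of signatures. -/
def pullback {S : Type (u + 1)} [Category.{u} S] (Φ : S ⥤ I.Sign) : StratInst.{u} where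
  Sign := S
  Sen := Φ ⋙ I.Sen
  Mod := Φ.op ⋙ I.Mod
  st s := I.st (Φ.obj s)
  stMap φ := I.stMap (Φ.map φ)
  stMap_id s M w := by
    have : ∀ (f : Φ.obj s ⟶ Φ.obj s), f = 𝟙 _ → HEq ((I.stMap f).app M w) w := by
      rintro _ rfl; exact I.stMap_id _ _ _
    exact this _ (Φ.map_id s)
  stMap_comp {a b c} φ ψ M w := by
    have : ∀ (f : Φ.obj a ⟶ Φ.obj c), f = Φ.map φ ≫ Φ.map ψ → HEq ((I.stMap f).app M w)
        ((I.stMap (Φ.map φ)).app _ ((I.stMap (Φ.map ψ)).app M w)) := by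
      rintro _ rfl; exact I.stMap_comp _ _ _ _
    exact this _ (Φ.map_comp φ ψ)
  Sat M w ρ := I.Sat M w ρ
  sat_cond φ M w ρ := I.sat_cond (Φ.map φ) M w ρ

def HasUltraproducts : Prop :=
  ∀ (S : I.Sign) (ι : Type u) (U : Ultrafilter ι) (M : ι → I.Mod.obj (op S)),
    Nonempty (FilteredProduct (U : Filter ι) M)

/-- There are `J ∈ F` and a state `k` of the product over `J` that is mapped to `w` and whose
projections satisfy `ρ` at all `j ∈ J`. -/
def FactorSat {S : I.Sign} {ι : Type u} {F : Filter ι} {M : ι → I.Mod.obj (op S)}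
    (A : FilteredProduct F M) (w : (I.st S).obj A.cocone.pt) (ρ : I.Sen.obj S) : Prop :=
  ∃ (J : {J : Set ι // J ∈ F}) (k : (I.st S).obj (A.prod J)),
    (I.st S).map (A.cocone.ι.app (op J)) k = w ∧
      ∀ j : J.1, I.Sat (M j) ((I.st S).map (A.proj J j) k) ρ

def PreservedByUltraproducts {S : I.Sign} (ρ : I.Sen.obj S) : Prop :=
  ∀ (ι : Type u) (U : Ultrafilter ι) (M : ι → I.Mod.obj (op S))
    (A : FilteredProduct (U : Filter ι) M) (w : (I.st S).obj A.cocone.pt),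
    I.FactorSat A w ρ → I.Sat A.cocone.pt w ρ

def PreservedByUltrafactors {S : I.Sign} (ρ : I.Sen.obj S) : Prop :=
  ∀ (ι : Type u) (U : Ultrafilter ι) (M : ι → I.Mod.obj (op S))
    (A : FilteredProduct (U : Filter ι) M) (w : (I.st S).obj A.cocone.pt),
    I.Sat A.cocone.pt w ρ → I.FactorSat A w ρ

end StratInst

/-! ## Kripke frames with nominals and polyadic modalities -/

/-- The modality symbols of the mono-modal logics: a single symbol `◇`, read as a binary
accessibility relation. -/
inductive Dia : ℕ → Type u
  | dia : Dia 2

/-- Nominals, and modality symbols `Mdl n` of arity `n` (to be interpreted as `n`-ary relations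
on worlds, so that `l : Mdl (n + 1)` yields an operator with `n` arguments). -/
structure FrameSig : Type (u + 1) where
  Nom : Type u
  Mdl : ℕ → Type u

namespace FrameSig

@[ext]
structure Hom (S T : FrameSig.{u}) where
  nom : S.Nom → T.Nom
  mdl : ∀ {n : ℕ}, S.Mdl n → T.Mdl n

instance : Category FrameSig.{u} where
  Hom S T := Hom S T
  id _ := ⟨id, id⟩
  comp f g := ⟨g.nom ∘ f.nom, g.mdl ∘ f.mdl⟩

end FrameSig

structure Frame (S : FrameSig.{u}) where
  W : Type u
  [ne : Nonempty W]
  nom : S.Nom → W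
  rel : ∀ {n : ℕ}, S.Mdl n → Set (Fin n → W)

namespace Frame

variable {S T : FrameSig.{u}}

@[ext]
structure Hom (M N : Frame S) where
  toFun : M.W → N.W
  map_nom : ∀ i, toFun (M.nom i) = N.nom i
  map_rel : ∀ {n : ℕ} (l : S.Mdl n) (v : Fin n → M.W), v ∈ M.rel l → toFun ∘ v ∈ N.rel l

instance : Category (Frame S) where
  Hom M N := Hom M N
  id _ := ⟨id, fun _ => rfl, fun _ _ h => h⟩
  comp f g := ⟨g.toFun ∘ f.toFun, fun i => by simp [f.map_nom, g.map_nom],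
    fun l v h => g.map_rel l _ (f.map_rel l v h)⟩

def reduct (φ : S ⟶ T) : Frame T ⥤ Frame S where
  obj M := { W := M.W, ne := M.ne, nom := fun i => M.nom (φ.nom i), rel := fun l => M.rel (φ.mdl l) }
  map h := ⟨h.toFun, fun i => h.map_nom (φ.nom i), fun l v hv => h.map_rel (φ.mdl l) v hv⟩

end Frame

/-! ## Propositional Kripke logics -/

/-- Formulas of polyadic modal propositional logic over the frame signature `S` and the set `P`
of propositional variables, with `k` bound nominal variables in scope. The formulas with `k = 0`
are the sentences; a formula with `k` variables is a sentence over `k` additional nominals. The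
hybrid constructors (nominal sentences, `@`, quantification over nominals) are available only when
`hyb = true`. -/
inductive PForm (hyb : Bool) (S : FrameSig.{u}) (P : Type u) : ℕ → Type u
  | atom {k : ℕ} (p : P) : PForm hyb S P k
  | and {k : ℕ} (ρ σ : PForm hyb S P k) : PForm hyb S P k
  | neg {k : ℕ} (ρ : PForm hyb S P k) : PForm hyb S P k
  | poss {k n : ℕ} (l : S.Mdl (n + 1)) (ρ : Fin n → PForm hyb S P k) : PForm hyb S P k
  | nom {k : ℕ} (h : hyb = true) (i : S.Nom ⊕ Fin k) : PForm hyb S P k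
  | sat {k : ℕ} (h : hyb = true) (i : S.Nom ⊕ Fin k) (ρ : PForm hyb S P k) : PForm hyb S P k
  | exNom {k : ℕ} (h : hyb = true) (ρ : PForm hyb S P (k + 1)) : PForm hyb S P k

abbrev PSig : Type (u + 1) := FrameSig.{u} × Type u

/-- Kripke structures `(W, M)`. -/
structure PModel (S : PSig.{u}) where
  frame : Frame S.1
  val : frame.W → Set S.2

namespace PModel

variable {S T : PSig.{u}}

@[ext]
structure Hom (M N : PModel S) where
  frame : M.frame ⟶ N.frame
  map_val : ∀ w, M.val w ⊆ N.val (frame.toFun w)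

instance : Category (PModel S) where
  Hom M N := Hom M N
  id _ := ⟨𝟙 _, fun _ _ h => h⟩
  comp f g := ⟨f.frame ≫ g.frame, fun w _ h => g.map_val _ (f.map_val w h)⟩

def reduct (φ : S ⟶ T) : PModel T ⥤ PModel S where
  obj M := ⟨(Frame.reduct φ.1).obj M.frame, fun w => {p | φ.2 p ∈ M.val w}⟩
  map h := ⟨(Frame.reduct φ.1).map h.frame, fun w _ hp => h.map_val w hp⟩

end PModel

namespace PForm

variable {hyb : Bool}

def map {S T : FrameSig.{u}} {P Q : Type u} (f : S ⟶ T) (g : P → Q) :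
    ∀ {k : ℕ}, PForm hyb S P k → PForm hyb T Q k
  | _, atom p => atom (g p)
  | _, and ρ σ => and (ρ.map f g) (σ.map f g)
  | _, neg ρ => neg (ρ.map f g)
  | _, poss l ρ => poss (f.mdl l) fun i => (ρ i).map f g
  | _, nom h i => nom h (Sum.map f.nom id i)
  | _, sat h i ρ => sat h (Sum.map f.nom id i) (ρ.map f g)
  | _, exNom h ρ => exNom h (ρ.map f g)

theorem map_id {S : FrameSig.{u}} {P : Type u} {k : ℕ} (ρ : PForm hyb S P k) :
    ρ.map (𝟙 S) id = ρ := by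
  have h : ∀ k (i : S.Nom ⊕ Fin k), Sum.map (FrameSig.Hom.nom (𝟙 S)) id i = i := by
    rintro k (i | i) <;> rfl
  induction ρ <;> simp only [map, *] <;> rfl

theorem map_comp {S T R : FrameSig.{u}} {P Q V : Type u} (f : S ⟶ T) (f' : T ⟶ R) (g : P → Q)
    (g' : Q → V) {k : ℕ} (ρ : PForm hyb S P k) :
    ρ.map (f ≫ f') (g' ∘ g) = (ρ.map f g).map f' g' := by
  have h : ∀ k (i : S.Nom ⊕ Fin k), Sum.map (f ≫ f').nom id i
      = Sum.map f'.nom id (Sum.map f.nom id i) := by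
    rintro k (i | i) <;> rfl
  induction ρ <;> simp only [map, *] <;> rfl

/-- Satisfaction at a world `w`, with `v` interpreting the bound nominal variables. -/
def Sat {S : PSig.{u}} (M : PModel S) :
    ∀ {k : ℕ}, PForm hyb S.1 S.2 k → (Fin k → M.frame.W) → M.frame.W → Prop
  | _, atom p, _, w => p ∈ M.val w
  | _, and ρ σ, v, w => Sat M ρ v w ∧ Sat M σ v w
  | _, neg ρ, v, w => ¬ Sat M ρ v w
  | _, poss l ρ, v, w => ∃ u, Fin.cons w u ∈ M.frame.rel l ∧ ∀ i, Sat M (ρ i) v (u i)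
  | _, nom _ i, v, w => Sum.elim M.frame.nom v i = w
  | _, sat _ i ρ, v, _ => Sat M ρ v (Sum.elim M.frame.nom v i)
  | _, exNom _ ρ, v, w => ∃ a, Sat M ρ (Fin.snoc v a) w

theorem sat_map {S T : PSig.{u}} (φ : S ⟶ T) (M : PModel T) {k : ℕ} (ρ : PForm hyb S.1 S.2 k)
    (v : Fin k → M.frame.W) (w : M.frame.W) :
    Sat ((PModel.reduct φ).obj M) ρ v w ↔ Sat M (ρ.map φ.1 φ.2) v w := by
  have h : ∀ k (i : S.1.Nom ⊕ Fin k) (v : Fin k → M.frame.W),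
      Sum.elim M.frame.nom v (Sum.map φ.1.nom id i)
        = Sum.elim ((PModel.reduct φ).obj M).frame.nom v i := by
    rintro k (i | i) v <;> rfl
  induction ρ generalizing w with
  | atom p => exact Iff.rfl
  | and ρ σ h1 h2 => exact and_congr (h1 _ _) (h2 _ _)
  | neg ρ h1 => exact not_congr (h1 _ _)
  | poss l ρ h1 => exact exists_congr fun u => and_congr Iff.rfl (forall_congr' fun i => h1 _ _ _)
  | nom hh i => simp only [map, Sat, h]; rfl
  | sat hh i ρ h1 => simp only [map, Sat, h]; exact h1 _ _
  | exNom hh ρ h1 => exact exists_congr fun a => h1 _ _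

end PForm

/-- Multi-modal propositional logic, hybrid when `hyb = true`. Its signatures are the tuples
(nominals, modalities, propositional variables). -/
def kripkeProp (hyb : Bool) : StratInst.{u} where
  Sign := PSig.{u}
  Sen :=
    { obj := fun S => PForm hyb S.1 S.2 0
      map := fun φ => ↾(PForm.map φ.1 φ.2)
      map_id := fun S => by ext ρ; exact ρ.map_id
      map_comp := fun φ ψ => by ext ρ; exact ρ.map_comp φ.1 ψ.1 φ.2 ψ.2 }
  Mod :=
    { obj := fun S => Cat.of (PModel S.unop)
      map := fun φ => (PModel.reduct φ.unop).toCatHom }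
  st S :=
    { obj := fun M => M.frame.W
      map := fun h => ↾h.frame.toFun }
  stMap φ := { app := fun M => 𝟙 M.frame.W }
  stMap_id _ _ _ := HEq.rfl
  stMap_comp _ _ _ _ := HEq.rfl
  Sat M w ρ := PForm.Sat M ρ Fin.elim0 w
  sat_cond φ M w ρ := PForm.sat_map φ M ρ _ w


/-- A first-order signature (single-sorted): function and predicate symbols of each arity. -/
abbrev FOLSig : Type (u + 1) := FirstOrder.Language.{u, u}

instance : Category FOLSig.{u} where
  Hom L L' := L →ᴸ L'
  id L := FirstOrder.Language.LHom.id L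
  comp f g := g.comp f

/-! ## First-order logic -/

structure IsFOHom {L : FOLSig.{u}} {D E : Type u} (s : L.Structure D) (t : L.Structure E)
    (h : D → E) : Prop where
  map_fun : ∀ {n : ℕ} (f : L.Functions n) (x : Fin n → D), h (s.funMap f x) = t.funMap f (h ∘ x)
  map_rel : ∀ {n : ℕ} (r : L.Relations n) (x : Fin n → D), s.RelMap r x → t.RelMap r (h ∘ x)

theorem IsFOHom.id {L : FOLSig.{u}} {D : Type u} (s : L.Structure D) : IsFOHom s s id :=
  ⟨fun _ _ => rfl, fun _ _ h => h⟩

theorem IsFOHom.comp {L : FOLSig.{u}} {D E G : Type u} {s : L.Structure D}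
    {t : L.Structure E} {r : L.Structure G} {h : D → E} {k : E → G} (hk : IsFOHom t r k)
    (hh : IsFOHom s t h) : IsFOHom s r (k ∘ h) :=
  ⟨fun f x => by simp [hh.map_fun, hk.map_fun, Function.comp_assoc],
    fun p x hx => hk.map_rel p _ (hh.map_rel p x hx)⟩

abbrev reductStr {L L' : FOLSig.{u}} (φ : L ⟶ L') {D : Type u} (s : L'.Structure D) :
    L.Structure D :=
  @FirstOrder.Language.LHom.reduct L L' φ D s

theorem realize_reduct {L L' : FOLSig.{u}} (φ : L ⟶ L') {D : Type u} (s : L'.Structure D)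
    {α : Type*} (t : L.Term α) (v : α → D) :
    @FirstOrder.Language.Term.realize L D (reductStr φ s) α v t
      = @FirstOrder.Language.Term.realize L' D s α v (FirstOrder.Language.LHom.onTerm φ t) := by
  induction t with
  | var => rfl
  | func f ts ih => simp only [FirstOrder.Language.LHom.onTerm, FirstOrder.Language.Term.realize, ih]; rfl

/-! ## First-order Kripke logics -/

/-- Formulas of polyadic modal first-order logic (without equality) with `k` bound nominal variables
and `m` bound first-order variables in scope; the sentences are those with `k = m = 0`. A formula is
a sentence over `k` additional nominals and `m` additional constants. The hybrid
constructors are available only when `hyb = true`. -/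
inductive QForm (hyb : Bool) (S : FrameSig.{u}) (L : FOLSig.{u}) : ℕ → ℕ → Type u
  | atom {k m n : ℕ} (r : L.Relations n) (t : Fin n → L.Term (Fin m)) : QForm hyb S L k m
  | and {k m : ℕ} (ρ σ : QForm hyb S L k m) : QForm hyb S L k m
  | neg {k m : ℕ} (ρ : QForm hyb S L k m) : QForm hyb S L k m
  | ex {k m : ℕ} (ρ : QForm hyb S L k (m + 1)) : QForm hyb S L k m
  | poss {k m n : ℕ} (l : S.Mdl (n + 1)) (ρ : Fin n → QForm hyb S L k m) : QForm hyb S L k m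
  | nom {k m : ℕ} (h : hyb = true) (i : S.Nom ⊕ Fin k) : QForm hyb S L k m
  | sat {k m : ℕ} (h : hyb = true) (i : S.Nom ⊕ Fin k) (ρ : QForm hyb S L k m) : QForm hyb S L k m
  | exNom {k m : ℕ} (h : hyb = true) (ρ : QForm hyb S L (k + 1) m) : QForm hyb S L k m

abbrev QSig : Type (u + 1) := FrameSig.{u} × FOLSig.{u}

/-- First-order Kripke structures: a first-order structure at each world, all on the same carrier
`D` and with the same interpretations of the constants. -/
structure QModel (S : QSig.{u}) where
  frame : Frame S.1
  D : Type u
  [ne : Nonempty D]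
  str : frame.W → S.2.Structure D
  rigid : ∀ (w w' : frame.W) (c : S.2.Functions 0) (x : Fin 0 → D),
    (str w).funMap c x = (str w').funMap c x

namespace QModel

variable {S T : QSig.{u}}

@[ext]
structure Hom (M N : QModel S) where
  frame : M.frame ⟶ N.frame
  toFun : M.D → N.D
  isHom : ∀ w, IsFOHom (M.str w) (N.str (frame.toFun w)) toFun

instance : Category (QModel S) where
  Hom M N := Hom M N
  id _ := ⟨𝟙 _, id, fun _ => IsFOHom.id _⟩
  comp f g := ⟨f.frame ≫ g.frame, g.toFun ∘ f.toFun, fun w => (g.isHom _).comp (f.isHom w)⟩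

def reduct (φ : S ⟶ T) : QModel T ⥤ QModel S where
  obj M :=
    { frame := (Frame.reduct φ.1).obj M.frame
      D := M.D
      ne := M.ne
      str := fun w => reductStr φ.2 (M.str w)
      rigid := fun w w' c x => M.rigid w w' (φ.2.onFunction c) x }
  map h := ⟨(Frame.reduct φ.1).map h.frame, h.toFun,
    fun w => ⟨fun f x => (h.isHom w).map_fun (φ.2.onFunction f) x,
      fun r x => (h.isHom w).map_rel (φ.2.onRelation r) x⟩⟩

end QModel

namespace QForm

variable {hyb : Bool}

def map {S T : FrameSig.{u}} {L L' : FOLSig.{u}} (f : S ⟶ T) (g : L ⟶ L') :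
    ∀ {k m : ℕ}, QForm hyb S L k m → QForm hyb T L' k m
  | _, _, atom r t => atom (g.onRelation r) fun j => g.onTerm (t j)
  | _, _, and ρ σ => and (ρ.map f g) (σ.map f g)
  | _, _, neg ρ => neg (ρ.map f g)
  | _, _, ex ρ => ex (ρ.map f g)
  | _, _, poss l ρ => poss (f.mdl l) fun i => (ρ i).map f g
  | _, _, nom h i => nom h (Sum.map f.nom id i)
  | _, _, sat h i ρ => sat h (Sum.map f.nom id i) (ρ.map f g)
  | _, _, exNom h ρ => exNom h (ρ.map f g)

theorem map_id {S : FrameSig.{u}} {L : FOLSig.{u}} {k m : ℕ} (ρ : QForm hyb S L k m) :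
    ρ.map (𝟙 S) (𝟙 L) = ρ := by
  have h : ∀ k (i : S.Nom ⊕ Fin k), Sum.map (FrameSig.Hom.nom (𝟙 S)) id i = i := by
    rintro k (i | i) <;> rfl
  have h' : ∀ {α : Type} (t : L.Term α), FirstOrder.Language.LHom.onTerm (𝟙 L) t = t :=
    fun t => congrFun FirstOrder.Language.LHom.id_onTerm t
  induction ρ <;> simp only [map, *] <;> rfl

theorem map_comp {S T R : FrameSig.{u}} {L L' L'' : FOLSig.{u}} (f : S ⟶ T) (f' : T ⟶ R)
    (g : L ⟶ L') (g' : L' ⟶ L'') {k m : ℕ} (ρ : QForm hyb S L k m) :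
    ρ.map (f ≫ f') (g ≫ g') = (ρ.map f g).map f' g' := by
  have h : ∀ k (i : S.Nom ⊕ Fin k), Sum.map (f ≫ f').nom id i
      = Sum.map f'.nom id (Sum.map f.nom id i) := by
    rintro k (i | i) <;> rfl
  have h' : ∀ {α : Type} (t : L.Term α), FirstOrder.Language.LHom.onTerm (g ≫ g') t
      = FirstOrder.Language.LHom.onTerm g' (FirstOrder.Language.LHom.onTerm g t) :=
    fun t => congrFun (FirstOrder.Language.LHom.comp_onTerm g' g) t
  induction ρ <;> simp only [map, *] <;> rfl

/-- Satisfaction at a world `w`, with `v` and `x` interpreting the bound nominal and first-order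
variables. -/
def Sat {S : QSig.{u}} (M : QModel S) :
    ∀ {k m : ℕ}, QForm hyb S.1 S.2 k m → (Fin k → M.frame.W) → (Fin m → M.D) → M.frame.W → Prop
  | _, _, atom r t, _, x, w =>
      (M.str w).RelMap r fun j => @FirstOrder.Language.Term.realize S.2 M.D (M.str w) _ x (t j)
  | _, _, and ρ σ, v, x, w => Sat M ρ v x w ∧ Sat M σ v x w
  | _, _, neg ρ, v, x, w => ¬ Sat M ρ v x w
  | _, _, ex ρ, v, x, w => ∃ d, Sat M ρ v (Fin.snoc x d) w
  | _, _, poss l ρ, v, x, w => ∃ u, Fin.cons w u ∈ M.frame.rel l ∧ ∀ i, Sat M (ρ i) v x (u i)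
  | _, _, nom _ i, v, _, w => Sum.elim M.frame.nom v i = w
  | _, _, sat _ i ρ, v, x, _ => Sat M ρ v x (Sum.elim M.frame.nom v i)
  | _, _, exNom _ ρ, v, x, w => ∃ a, Sat M ρ (Fin.snoc v a) x w

theorem sat_map {S T : QSig.{u}} (φ : S ⟶ T) (M : QModel T) {k m : ℕ} (ρ : QForm hyb S.1 S.2 k m)
    (v : Fin k → M.frame.W) (x : Fin m → M.D) (w : M.frame.W) :
    Sat ((QModel.reduct φ).obj M) ρ v x w ↔ Sat M (ρ.map φ.1 φ.2) v x w := by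
  have h : ∀ k (i : S.1.Nom ⊕ Fin k) (v : Fin k → M.frame.W),
      Sum.elim M.frame.nom v (Sum.map φ.1.nom id i)
        = Sum.elim ((QModel.reduct φ).obj M).frame.nom v i := by
    rintro k (i | i) v <;> rfl
  induction ρ generalizing w with
  | atom r t => simp only [map, Sat, ← realize_reduct]; rfl
  | and ρ σ h1 h2 => exact and_congr (h1 _ _ _) (h2 _ _ _)
  | neg ρ h1 => exact not_congr (h1 _ _ _)
  | ex ρ h1 => exact exists_congr fun d => h1 _ _ _
  | poss l ρ h1 =>
    exact exists_congr fun u => and_congr Iff.rfl (forall_congr' fun i => h1 _ _ _ _)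
  | nom hh i => simp only [map, Sat, h]; rfl
  | sat hh i ρ h1 => simp only [map, Sat, h]; exact h1 _ _ _
  | exNom hh ρ h1 => exact exists_congr fun a => h1 _ _ _

end QForm

/-- Multi-modal first-order logic, hybrid when `hyb = true`. Its signatures are the tuples
(nominals, modalities, first-order signature). -/
def kripkeFO (hyb : Bool) : StratInst.{u} where
  Sign := QSig.{u}
  Sen :=
    { obj := fun S => QForm hyb S.1 S.2 0 0
      map := fun φ => ↾(QForm.map φ.1 φ.2)
      map_id := fun S => by ext ρ; exact ρ.map_id
      map_comp := fun φ ψ => by ext ρ; exact ρ.map_comp φ.1 ψ.1 φ.2 ψ.2 }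
  Mod :=
    { obj := fun S => Cat.of (QModel S.unop)
      map := fun φ => (QModel.reduct φ.unop).toCatHom }
  st S :=
    { obj := fun M => M.frame.W
      map := fun h => ↾h.frame.toFun }
  stMap φ := { app := fun M => 𝟙 M.frame.W }
  stMap_id _ _ _ := HEq.rfl
  stMap_comp _ _ _ _ := HEq.rfl
  Sat M w ρ := QForm.Sat M ρ Fin.elim0 Fin.elim0 w
  sat_cond φ M w ρ := QForm.sat_map φ M ρ _ _ w


/-! ## Open first-order logics -/

structure FModel (L : FOLSig.{u}) where
  D : Type u
  [ne : Nonempty D]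
  str : L.Structure D

namespace FModel

variable {L L' : FOLSig.{u}}

@[ext]
structure Hom (M N : FModel L) where
  toFun : M.D → N.D
  isHom : IsFOHom M.str N.str toFun

instance : Category (FModel L) where
  Hom M N := Hom M N
  id _ := ⟨id, IsFOHom.id _⟩
  comp f g := ⟨g.toFun ∘ f.toFun, g.isHom.comp f.isHom⟩

def reduct (φ : L ⟶ L') : FModel L' ⥤ FModel L where
  obj M := { D := M.D, ne := M.ne, str := reductStr φ M.str }
  map h := ⟨h.toFun, fun f x => h.isHom.map_fun (φ.onFunction f) x,
    fun r x => h.isHom.map_rel (φ.onRelation r) x⟩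

/-- The interpretation of `r` in the power `M ^ X`. -/
def powRel (M : FModel L) (X : Type u) {n : ℕ} (r : L.Relations n) : Set (Fin n → X → M.D) :=
  {u | ∀ x, M.str.RelMap r fun j => u j x}

end FModel

/-- Formulas over the first-order signature `L` and the block `X` of variables, with `k` bound
variables in scope. Each bound variable is a fresh constant added to `L`, so it may occur in terms
and also, when `hyb = true`, as a nominal; hence `ex` is both the first-order quantifier and the
quantifier over nominals. With `hyb = modal = false` the formulas with `k = 0` are the first-order
sentences over `L` extended with the constants `X`. -/
inductive OForm (hyb modal : Bool) (L : FOLSig.{u}) (X : Type u) : ℕ → Type u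
  | atom {k n : ℕ} (r : L.Relations n) (t : Fin n → L.Term (X ⊕ Fin k)) : OForm hyb modal L X k
  | and {k : ℕ} (ρ σ : OForm hyb modal L X k) : OForm hyb modal L X k
  | neg {k : ℕ} (ρ : OForm hyb modal L X k) : OForm hyb modal L X k
  | ex {k : ℕ} (ρ : OForm hyb modal L X (k + 1)) : OForm hyb modal L X k
  | poss {k n : ℕ} (h : modal = true) (r : L.Relations (n + 1))
      (ρ : Fin n → OForm hyb modal L X k) : OForm hyb modal L X k
  | nom {k : ℕ} (h : hyb = true) (i : L.Functions 0 ⊕ Fin k) : OForm hyb modal L X k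
  | sat {k : ℕ} (h : hyb = true) (i : L.Functions 0 ⊕ Fin k) (ρ : OForm hyb modal L X k) :
      OForm hyb modal L X k

/-- Signatures `(L, X)` with `X` a finite block of variables, taken from a set `V`. -/
structure OSig (V : Type u) (hyb modal : Bool) : Type (u + 1) where
  lang : FOLSig.{u}
  X : Finset V

namespace OSig

variable {V : Type u} {hyb modal : Bool}

/-- Morphisms `(L, X) → (L', X')` are first-order signature morphisms such that `X ⊆ X'`. In the
presence of modalities or nominals the satisfaction condition fails for a proper inclusion, and
`X = X'` is required. -/
@[ext]
structure Hom (S T : OSig V hyb modal) where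
  lang : S.lang ⟶ T.lang
  sub : S.X ⊆ T.X
  eq : (hyb || modal) = true → S.X = T.X

instance : Category (OSig V hyb modal) where
  Hom S T := Hom S T
  id S := ⟨𝟙 _, subset_rfl, fun _ => rfl⟩
  comp f g := ⟨f.lang ≫ g.lang, f.sub.trans g.sub, fun h => (f.eq h).trans (g.eq h)⟩

def onVar {S T : OSig V hyb modal} (φ : S ⟶ T) (x : S.X) : T.X := ⟨x.1, φ.sub x.2⟩

theorem onVar_surjective {S T : OSig V hyb modal} (φ : S ⟶ T) (h : (hyb || modal) = true) :
    Function.Surjective (onVar φ) :=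
  fun y => ⟨⟨y.1, (φ.eq h).symm ▸ y.2⟩, rfl⟩

end OSig

namespace OForm

variable {hyb modal : Bool}

def map {L L' : FOLSig.{u}} {X Y : Type u} (g : L ⟶ L') (f : X → Y) :
    ∀ {k : ℕ}, OForm hyb modal L X k → OForm hyb modal L' Y k
  | _, atom r t => atom (g.onRelation r) fun j => g.onTerm ((t j).relabel (Sum.map f id))
  | _, and ρ σ => and (ρ.map g f) (σ.map g f)
  | _, neg ρ => neg (ρ.map g f)
  | _, ex ρ => ex (ρ.map g f)
  | _, poss h r ρ => poss h (g.onRelation r) fun i => (ρ i).map g f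
  | _, nom h i => nom h (Sum.map (fun c => g.onFunction c) id i)
  | _, sat h i ρ => sat h (Sum.map (fun c => g.onFunction c) id i) (ρ.map g f)

theorem map_id {L : FOLSig.{u}} {X : Type u} {k : ℕ} (ρ : OForm hyb modal L X k) :
    ρ.map (𝟙 L) id = ρ := by
  have h : ∀ k (i : L.Functions 0 ⊕ Fin k),
      Sum.map (fun c => FirstOrder.Language.LHom.onFunction (𝟙 L) c) id i = i := by
    rintro k (i | i) <;> rfl
  have h' : ∀ {α : Type u} (t : L.Term α), FirstOrder.Language.LHom.onTerm (𝟙 L) t = t :=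
    fun t => congrFun FirstOrder.Language.LHom.id_onTerm t
  induction ρ <;> simp only [map, Sum.map_id_id, FirstOrder.Language.Term.relabel_id, *] <;> rfl

theorem onTerm_relabel {L L' : FOLSig.{u}} (g : L ⟶ L') {α β : Type u} (f : α → β) (t : L.Term α) :
    FirstOrder.Language.LHom.onTerm g (t.relabel f)
      = (FirstOrder.Language.LHom.onTerm g t).relabel f := by
  induction t with
  | var => rfl
  | func F ts ih =>
    simp only [FirstOrder.Language.LHom.onTerm, FirstOrder.Language.Term.relabel, ih]

theorem map_comp {L L' L'' : FOLSig.{u}} {X Y Z : Type u} (g : L ⟶ L') (g' : L' ⟶ L'')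
    (f : X → Y) (f' : Y → Z) {k : ℕ} (ρ : OForm hyb modal L X k) :
    ρ.map (g ≫ g') (f' ∘ f) = (ρ.map g f).map g' f' := by
  have h : ∀ k (i : L.Functions 0 ⊕ Fin k),
      Sum.map (fun c => FirstOrder.Language.LHom.onFunction (g ≫ g') c) id i
        = Sum.map (fun c => g'.onFunction c) id (Sum.map (fun c => g.onFunction c) id i) := by
    rintro k (i | i) <;> rfl
  have h' : ∀ k (t : L.Term (X ⊕ Fin k)),
      FirstOrder.Language.LHom.onTerm (g ≫ g') (t.relabel (Sum.map (f' ∘ f) id))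
      = FirstOrder.Language.LHom.onTerm g' ((FirstOrder.Language.LHom.onTerm g
          (t.relabel (Sum.map f id))).relabel (Sum.map f' id)) := by
    intro k t
    rw [← onTerm_relabel, FirstOrder.Language.Term.relabel_relabel, Sum.map_comp_map]
    exact congrFun (FirstOrder.Language.LHom.comp_onTerm g' g) _
  induction ρ <;> simp only [map, *] <;> rfl

/-- Satisfaction at a state `w`, with `c` interpreting the bound variables. -/
def Sat {L : FOLSig.{u}} {X : Type u} (M : FModel L) :
    ∀ {k : ℕ}, OForm hyb modal L X k → (Fin k → M.D) → (X → M.D) → Prop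
  | _, atom r t, c, w =>
      M.str.RelMap r fun j => @FirstOrder.Language.Term.realize L M.D M.str _ (Sum.elim w c) (t j)
  | _, and ρ σ, c, w => Sat M ρ c w ∧ Sat M σ c w
  | _, neg ρ, c, w => ¬ Sat M ρ c w
  | _, ex ρ, c, w => ∃ d, Sat M ρ (Fin.snoc c d) w
  | _, poss _ r ρ, c, w => ∃ u, Fin.cons w u ∈ M.powRel X r ∧ ∀ i, Sat M (ρ i) c (u i)
  | _, nom _ i, c, w => (fun _ => Sum.elim (fun a => M.str.funMap a Fin.elim0) c i) = w
  | _, sat _ i ρ, c, _ => Sat M ρ c fun _ => Sum.elim (fun a => M.str.funMap a Fin.elim0) c i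

theorem sat_map {V : Type u} {S T : OSig V hyb modal} (φ : S ⟶ T) (M : FModel T.lang) {k : ℕ}
    (ρ : OForm hyb modal S.lang S.X k) (c : Fin k → M.D) (w : T.X → M.D) :
    Sat ((FModel.reduct φ.lang).obj M) ρ c (w ∘ OSig.onVar φ)
      ↔ Sat M (ρ.map φ.lang (OSig.onVar φ)) c w := by
  have h : ∀ k (i : S.lang.Functions 0 ⊕ Fin k) (c : Fin k → M.D),
      Sum.elim (fun a => M.str.funMap a Fin.elim0) c
          (Sum.map (fun c => φ.lang.onFunction c) id i)
        = Sum.elim (fun a => (reductStr φ.lang M.str).funMap a Fin.elim0) c i := by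
    rintro k (i | i) c <;> rfl
  induction ρ generalizing w with
  | atom r t =>
    have : ∀ j, @FirstOrder.Language.Term.realize _ M.D M.str _ (Sum.elim w c)
        (FirstOrder.Language.LHom.onTerm φ.lang ((t j).relabel (Sum.map (OSig.onVar φ) id)))
        = @FirstOrder.Language.Term.realize _ M.D (reductStr φ.lang M.str) _
          (Sum.elim (w ∘ OSig.onVar φ) c) (t j) := by
      intro j
      refine (realize_reduct φ.lang M.str _ _).symm.trans ?_
      refine (@FirstOrder.Language.Term.realize_relabel S.lang M.D (reductStr φ.lang M.str)
        _ _ (t j) _ _).trans ?_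
      rw [Sum.elim_comp_map]
      rfl
    simp only [map, Sat, this]; rfl
  | and ρ σ h1 h2 => exact and_congr (h1 _ _) (h2 _ _)
  | neg ρ h1 => exact not_congr (h1 _ _)
  | ex ρ h1 => exact exists_congr fun d => h1 _ _
  | @poss k n hm r ρ h1 =>
    have hs := OSig.onVar_surjective φ (by simp [hm])
    have hinj : Function.Injective (OSig.onVar φ) := fun a b hab =>
      Subtype.ext (congrArg (fun y : T.X => y.1) hab)
    let e := Equiv.ofBijective _ ⟨hinj, hs⟩
    have hc : ∀ (u : Fin n → T.X → M.D) (x : S.X),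
        (fun j => (Fin.cons (w ∘ OSig.onVar φ) (fun i => u i ∘ OSig.onVar φ) :
          Fin (n + 1) → S.X → M.D) j x)
        = fun j => (Fin.cons w u : Fin (n + 1) → T.X → M.D) j (OSig.onVar φ x) := by
      intro u x; funext j; cases j using Fin.cases <;> rfl
    constructor
    · rintro ⟨u, hu, hu'⟩
      have hue : (fun i => (fun y => u i (e.symm y)) ∘ OSig.onVar φ) = u := by
        funext i x; exact congrArg (u i) (e.symm_apply_apply x)
      refine ⟨fun i y => u i (e.symm y), fun y => ?_, fun i => (h1 _ _ _).1
        ((congrArg (fun u => Sat ((FModel.reduct φ.lang).obj M) (ρ i) c (u i)) hue).mpr (hu' i))⟩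
      obtain ⟨x, rfl⟩ := hs y
      refine (congrArg (M.str.RelMap (φ.lang.onRelation r)) ?_).mp (hu x)
      refine Eq.trans ?_ (hc (fun i y => u i (e.symm y)) x)
      exact congrArg (fun u : Fin n → S.X → M.D =>
        fun j => (Fin.cons (w ∘ OSig.onVar φ) u : Fin (n + 1) → S.X → M.D) j x) hue.symm
    · rintro ⟨u, hu, hu'⟩
      exact ⟨fun i => u i ∘ OSig.onVar φ, fun x =>
        (congrArg (M.str.RelMap (φ.lang.onRelation r)) (hc u x)).mpr (hu _),
        fun i => (h1 _ _ _).2 (hu' i)⟩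
  | nom hh i =>
    have hs := OSig.onVar_surjective φ (by simp [hh])
    simp only [map, Sat, h]
    exact hs.injective_comp_right.eq_iff (a := fun _ => _) (b := w)
  | sat hh i ρ h1 =>
    exact (h1 _ _).trans (Iff.of_eq (congrArg (fun d => Sat M (ρ.map _ _) c fun _ => d)
      (h _ i c).symm))

end OForm

/-- Open first-order logic, with nominals when `hyb = true` and with modalities when
`modal = true`. The states of a model `M` over `(L, X)` are the valuations of `X` in `M`. -/
def openFO (V : Type u) (hyb modal : Bool) : StratInst.{u} where
  Sign := OSig V hyb modal
  Sen :=
    { obj := fun S => OForm hyb modal S.lang S.X 0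
      map := fun φ => ↾(OForm.map φ.lang (OSig.onVar φ))
      map_id := fun S => by ext ρ; exact ρ.map_id
      map_comp := fun φ ψ => by ext ρ; exact ρ.map_comp φ.lang ψ.lang (OSig.onVar φ) (OSig.onVar ψ) }
  Mod :=
    { obj := fun S => Cat.of (FModel S.unop.lang)
      map := fun φ => (FModel.reduct φ.unop.lang).toCatHom }
  st S :=
    { obj := fun M => S.X → M.D
      map := fun h => ↾(fun w => h.toFun ∘ w) }
  stMap φ := { app := fun M => ↾(fun w => w ∘ OSig.onVar φ) }
  stMap_id _ _ _ := HEq.rfl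
  stMap_comp _ _ _ _ := HEq.rfl
  Sat M w ρ := OForm.Sat M ρ Fin.elim0 w
  sat_cond φ M w ρ := OForm.sat_map φ M ρ _ w

/-! ## Double hybridization of propositional logic -/

structure HHSig : Type (u + 1) where
  Nom₀ : Type u
  Nom₁ : Type u
  P : Type u

namespace HHSig

@[ext]
structure Hom (S T : HHSig.{u}) where
  nom₀ : S.Nom₀ → T.Nom₀
  nom₁ : S.Nom₁ → T.Nom₁
  prp : S.P → T.P

instance : Category HHSig.{u} where
  Hom S T := Hom S T
  id _ := ⟨id, id, id⟩
  comp f g := ⟨g.nom₀ ∘ f.nom₀, g.nom₁ ∘ f.nom₁, g.prp ∘ f.prp⟩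

/-- The signature of the lower hybrid propositional logic. -/
def lower : HHSig.{u} ⥤ PSig.{u} where
  obj S := (⟨S.Nom₀, Dia⟩, S.P)
  map f := (⟨f.nom₀, id⟩, ↾f.prp)

/-- The frame signature of the upper layer. -/
def upper : HHSig.{u} ⥤ FrameSig.{u} where
  obj S := ⟨S.Nom₁, Dia⟩
  map f := ⟨f.nom₁, id⟩

end HHSig

/-- Kripke structures (the upper layer, `frame`) of hybrid propositional Kripke structures, all of
which share their set of worlds `W₀` and their interpretations `nom₀` of the lower nominals. -/
structure HHModel (S : HHSig.{u}) where
  frame : Frame (HHSig.upper.obj S)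
  W₀ : Type u
  [ne : Nonempty W₀]
  nom₀ : S.Nom₀ → W₀
  rel₀ : frame.W → ∀ {n : ℕ}, Dia.{u} n → Set (Fin n → W₀)
  val : frame.W → W₀ → Set S.P

namespace HHModel

variable {S T : HHSig.{u}}

/-- The hybrid propositional model at the upper world `w`. -/
def loc (M : HHModel S) (w : M.frame.W) : PModel (HHSig.lower.obj S) where
  frame := { W := M.W₀, ne := M.ne, nom := M.nom₀, rel := M.rel₀ w }
  val := M.val w

@[ext]
structure Hom (M N : HHModel S) where
  frame : M.frame ⟶ N.frame
  toFun : M.W₀ → N.W₀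
  isHom : ∀ w, ∃ h : M.loc w ⟶ N.loc (frame.toFun w), h.frame.toFun = toFun

instance : Category (HHModel S) where
  Hom M N := Hom M N
  id M := ⟨𝟙 _, id, fun w => ⟨𝟙 (M.loc w), rfl⟩⟩
  comp f g := ⟨f.frame ≫ g.frame, g.toFun ∘ f.toFun, fun w => by
    obtain ⟨a, ha⟩ := f.isHom w
    obtain ⟨b, hb⟩ := g.isHom (f.frame.toFun w)
    exact ⟨a ≫ b, by rw [← ha, ← hb]; rfl⟩⟩

def reduct (φ : S ⟶ T) : HHModel T ⥤ HHModel S where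
  obj M :=
    { frame := (Frame.reduct (HHSig.upper.map φ)).obj M.frame
      W₀ := M.W₀
      ne := M.ne
      nom₀ := M.nom₀ ∘ φ.nom₀
      rel₀ := M.rel₀
      val := fun w v => {p | φ.prp p ∈ M.val w v} }
  map h := ⟨(Frame.reduct (HHSig.upper.map φ)).map h.frame, h.toFun, fun w => by
    obtain ⟨a, ha⟩ := h.isHom w
    exact ⟨(PModel.reduct (HHSig.lower.map φ)).map a, ha⟩⟩

end HHModel

/-- Formulas with `j` bound lower nominals and `k` bound upper nominals in scope. The sentences of
the lower logic serve as atoms (`base`); the other constructors belong to the upper layer,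
which has quantifiers over the nominals of both layers. -/
inductive HHForm (S : HHSig.{u}) : ℕ → ℕ → Type u
  | base {j k : ℕ} (ρ : PForm true (HHSig.lower.obj S).1 (HHSig.lower.obj S).2 j) : HHForm S j k
  | and {j k : ℕ} (ρ σ : HHForm S j k) : HHForm S j k
  | neg {j k : ℕ} (ρ : HHForm S j k) : HHForm S j k
  | dia {j k : ℕ} (ρ : HHForm S j k) : HHForm S j k
  | nom {j k : ℕ} (i : S.Nom₁ ⊕ Fin k) : HHForm S j k
  | sat {j k : ℕ} (i : S.Nom₁ ⊕ Fin k) (ρ : HHForm S j k) : HHForm S j k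
  | exNom₁ {j k : ℕ} (ρ : HHForm S j (k + 1)) : HHForm S j k
  | exNom₀ {j k : ℕ} (ρ : HHForm S (j + 1) k) : HHForm S j k

namespace HHForm

def map {S T : HHSig.{u}} (f : S ⟶ T) : ∀ {j k : ℕ}, HHForm S j k → HHForm T j k
  | _, _, base ρ => base (ρ.map (HHSig.lower.map f).1 (HHSig.lower.map f).2)
  | _, _, and ρ σ => and (ρ.map f) (σ.map f)
  | _, _, neg ρ => neg (ρ.map f)
  | _, _, dia ρ => dia (ρ.map f)
  | _, _, nom i => nom (Sum.map f.nom₁ id i)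
  | _, _, sat i ρ => sat (Sum.map f.nom₁ id i) (ρ.map f)
  | _, _, exNom₁ ρ => exNom₁ (ρ.map f)
  | _, _, exNom₀ ρ => exNom₀ (ρ.map f)

theorem map_id {S : HHSig.{u}} {j k : ℕ} (ρ : HHForm S j k) : ρ.map (𝟙 S) = ρ := by
  have h : ∀ k (i : S.Nom₁ ⊕ Fin k), Sum.map (HHSig.Hom.nom₁ (𝟙 S)) id i = i := by
    rintro k (i | i) <;> rfl
  have h' : ∀ j (ρ : PForm true (HHSig.lower.obj S).1 (HHSig.lower.obj S).2 j),
      ρ.map (HHSig.lower.map (𝟙 S)).1 (HHSig.lower.map (𝟙 S)).2 = ρ := fun j ρ => ρ.map_id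
  induction ρ <;> simp only [map, *]

theorem map_comp {S T R : HHSig.{u}} (f : S ⟶ T) (g : T ⟶ R) {j k : ℕ} (ρ : HHForm S j k) :
    ρ.map (f ≫ g) = (ρ.map f).map g := by
  have h : ∀ k (i : S.Nom₁ ⊕ Fin k), Sum.map (f ≫ g).nom₁ id i
      = Sum.map g.nom₁ id (Sum.map f.nom₁ id i) := by
    rintro k (i | i) <;> rfl
  have h' : ∀ j (ρ : PForm true (HHSig.lower.obj S).1 (HHSig.lower.obj S).2 j),
      ρ.map (HHSig.lower.map (f ≫ g)).1 (HHSig.lower.map (f ≫ g)).2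
        = (ρ.map (HHSig.lower.map f).1 (HHSig.lower.map f).2).map (HHSig.lower.map g).1
            (HHSig.lower.map g).2 := fun j ρ =>
    ρ.map_comp (HHSig.lower.map f).1 (HHSig.lower.map g).1 f.prp g.prp
  induction ρ <;> simp only [map, *]

/-- Satisfaction at an upper world `w`. A sentence of the lower logic holds at `w` when it holds
globally, i.e. at every world, in the hybrid propositional model at `w`. -/
def Sat {S : HHSig.{u}} (M : HHModel S) :
    ∀ {j k : ℕ}, HHForm S j k → (Fin j → M.W₀) → (Fin k → M.frame.W) → M.frame.W → Prop
  | _, _, base ρ, x, _, w => ∀ a : M.W₀, PForm.Sat (M.loc w) ρ x a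
  | _, _, and ρ σ, x, v, w => Sat M ρ x v w ∧ Sat M σ x v w
  | _, _, neg ρ, x, v, w => ¬ Sat M ρ x v w
  | _, _, dia ρ, x, v, w => ∃ w', ![w, w'] ∈ M.frame.rel Dia.dia ∧ Sat M ρ x v w'
  | _, _, nom i, _, v, w => Sum.elim M.frame.nom v i = w
  | _, _, sat i ρ, x, v, _ => Sat M ρ x v (Sum.elim M.frame.nom v i)
  | _, _, exNom₁ ρ, x, v, w => ∃ a, Sat M ρ x (Fin.snoc v a) w
  | _, _, exNom₀ ρ, x, v, w => ∃ a, Sat M ρ (Fin.snoc x a) v w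

theorem sat_map {S T : HHSig.{u}} (φ : S ⟶ T) (M : HHModel T) {j k : ℕ} (ρ : HHForm S j k)
    (x : Fin j → M.W₀) (v : Fin k → M.frame.W) (w : M.frame.W) :
    Sat ((HHModel.reduct φ).obj M) ρ x v w ↔ Sat M (ρ.map φ) x v w := by
  have h : ∀ k (i : S.Nom₁ ⊕ Fin k) (v : Fin k → M.frame.W),
      Sum.elim M.frame.nom v (Sum.map φ.nom₁ id i)
        = Sum.elim ((HHModel.reduct φ).obj M).frame.nom v i := by
    rintro k (i | i) v <;> rfl
  induction ρ generalizing w with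
  | base ρ => exact forall_congr' fun a => PForm.sat_map (HHSig.lower.map φ) (M.loc w) ρ x a
  | and ρ σ h1 h2 => exact and_congr (h1 _ _ _) (h2 _ _ _)
  | neg ρ h1 => exact not_congr (h1 _ _ _)
  | dia ρ h1 => exact exists_congr fun u => and_congr Iff.rfl (h1 _ _ _)
  | nom i => exact Iff.of_eq (congrArg (· = w) (h _ i v).symm)
  | sat i ρ h1 =>
    exact (h1 _ _ _).trans (Iff.of_eq (congrArg (Sat M (ρ.map φ) x v) (h _ i v).symm))
  | exNom₁ ρ h1 => exact exists_congr fun a => h1 _ _ _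
  | exNom₀ ρ h1 => exact exists_congr fun a => h1 _ _ _

end HHForm

def hhpl : StratInst.{u} where
  Sign := HHSig.{u}
  Sen :=
    { obj := fun S => HHForm S 0 0
      map := fun φ => ↾(HHForm.map φ)
      map_id := fun S => by ext ρ; exact ρ.map_id
      map_comp := fun φ ψ => by ext ρ; exact ρ.map_comp φ ψ }
  Mod :=
    { obj := fun S => Cat.of (HHModel S.unop)
      map := fun φ => (HHModel.reduct φ.unop).toCatHom }
  st S :=
    { obj := fun M => M.frame.W
      map := fun h => ↾h.frame.toFun }
  stMap φ := { app := fun M => 𝟙 M.frame.W }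
  stMap_id _ _ _ := HEq.rfl
  stMap_comp _ _ _ _ := HEq.rfl
  Sat M w ρ := HHForm.Sat M ρ Fin.elim0 Fin.elim0 w
  sat_cond φ M w ρ := HHForm.sat_map φ M ρ _ _ w

/-! ## The benchmark examples -/

/-- No nominals, a single binary modality. -/
def plainSig : FrameSig.{u} := ⟨PEmpty, Dia⟩

/-- Nominals, a single binary modality. -/
def nomSig : Type u ⥤ FrameSig.{u} where
  obj N := ⟨N, Dia⟩
  map f := ⟨f, id⟩

/-- No nominals, arbitrary modalities. -/
def mdlSig : (ℕ → Type u) ⥤ FrameSig.{u} where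
  obj Λ := ⟨PEmpty, Λ⟩
  map f := ⟨id, fun {n} l => f n l⟩

inductive Benchmark
  | MPL | MFOL | HPL | HFOL | MMPL | MHPL | MMFOL | MHFOL | HHPL | OFOL | MOFOL | HOFOL | HMOFOL

/-- The benchmark stratified institutions. In the last four, `V` is the set from which
the blocks of variables are taken. -/
def Benchmark.inst (V : Type u) : Benchmark → StratInst.{u}
  | MPL => (kripkeProp false).pullback (Prod.sectR plainSig (Type u))
  | HPL => (kripkeProp true).pullback (nomSig.prod (𝟭 (Type u)))
  | MMPL => (kripkeProp false).pullback (mdlSig.prod (𝟭 (Type u)))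
  | MHPL => kripkeProp true
  | MFOL => (kripkeFO false).pullback (Prod.sectR plainSig FOLSig)
  | HFOL => (kripkeFO true).pullback (nomSig.prod (𝟭 FOLSig))
  | MMFOL => (kripkeFO false).pullback (mdlSig.prod (𝟭 FOLSig))
  | MHFOL => kripkeFO true
  | HHPL => hhpl
  | OFOL => openFO V false false
  | MOFOL => openFO V false true
  | HOFOL => openFO V true false
  | HMOFOL => openFO V true true

end Strat

namespace Strat

/-! The core is a Łoś theorem. In each of these logics a family of models has a concrete
ultraproduct: worlds and carriers are set-theoretic ultraproducts, and a relation holds when it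
holds in `U`-almost all factors. A state represented by a family `k` then satisfies `ρ` iff `k i`
satisfies `ρ` in the `i`-th factor for `U`-almost all `i`. This goes by induction on formulas.
Conjunction uses closure of `U` under intersection, negation uses maximality of `U`. All existential
steps (elements, nominals, tuples of worlds for a modality) use surjectivity of the projection from
the full product and a choice of witnesses, as in `IsUltra.exists_iff_of_surjective`. Finite
arities, and finite blocks of variables in the open logics, ensure that only finitely many
coordinate conditions are ever combined.

The concrete ultraproduct is also the categorical one (`ProductSystem.filteredProduct`). Since
carriers are non-empty, a family over `J ∈ U` extends to all indices, so every class has a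
representative in the full product, and a map out of the ultraproduct is determined there. The
smaller `J` are still indispensable: a relation that holds in the ultraproduct may hold only on some
`J`, and it is the cocone component at that `J` which shows that the induced map preserves it.

Products and colimits are unique up to isomorphism and satisfaction is invariant under isomorphism,
so the concrete statement transfers to arbitrary ultraproducts: `sat_iff_factorSat` identifies
satisfaction with (∗), where `J` is the set of indices at which `ρ` holds. Isomorphism invariance is
itself an instance of Łoś, over the principal ultrafilter on a one-point set (`isUltra_pure`).

Model compactness follows by an ultraproduct indexed by the finite subsets of `E`. Local compactness
then follows by adjoining a negation of the conclusion. Everything is derived from the interface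
`StratInst.IsLos`, which is verified for four generic logics (`kripkeProp_isLos`, `kripkeFO_isLos`,
`openFO_isLos`, `hhpl_isLos`) and passes to restrictions along signature functors. -/

/-! ## Ultraproducts of sets -/

/-- `q` exhibits `Y` as the ultraproduct of the family `X`. -/
structure IsUltra {ι : Type u} (U : Ultrafilter ι) {X : ι → Type u} {Y : Type u}
    (q : (∀ i, X i) → Y) : Prop where
  surj : Function.Surjective q
  eq_iff : ∀ k k', q k = q k' ↔ ∀ᶠ i in U, k i = k' i

/-- The map induced by `q` on `κ`-indexed tuples. -/
def tuple {ι : Type u} {X : ι → Type u} {Y : Type u} (q : (∀ i, X i) → Y) {κ : Type*}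
    (k : ∀ i, κ → X i) : κ → Y :=
  fun c => q fun i => k i c

namespace IsUltra

variable {ι : Type u} {U : Ultrafilter ι} {X : ι → Type u} {Y : Type u} {q : (∀ i, X i) → Y}

theorem tuple_surjective (h : IsUltra U q) (κ : Type*) :
    Function.Surjective (tuple q (κ := κ)) := fun y => by
  choose k hk using fun c => h.surj (y c)
  exact ⟨fun i c => k c i, funext hk⟩

/-- Finitely many coordinatewise equalities, each valid on a member of `U`, are valid together on
one member. Surjectivity of `tuple`, by contrast, needs no finiteness. -/
theorem tuple_eq_iff (h : IsUltra U q) {κ : Type*} [Finite κ] (k k' : ∀ i, κ → X i) :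
    tuple q k = tuple q k' ↔ ∀ᶠ i in U, k i = k' i := by
  simp only [funext_iff, tuple, h.eq_iff, Filter.eventually_all]

theorem exists_iff_of_surjective {Z : ι → Type*} [∀ i, Nonempty (Z i)] {V : Type*}
    {r : (∀ i, Z i) → V} (hr : Function.Surjective r) {p : V → Prop} {P : ∀ i, Z i → Prop}
    (hp : ∀ k, p (r k) ↔ ∀ᶠ i in U, P i (k i)) : (∃ y, p y) ↔ ∀ᶠ i in U, ∃ x, P i x := by
  constructor
  · rintro ⟨y, hy⟩
    obtain ⟨k, rfl⟩ := hr y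
    exact ((hp k).1 hy).mono fun i hi => ⟨_, hi⟩
  · intro H
    classical
    -- Witnesses are chosen wherever they exist; elsewhere any value will do, since those indices
    -- lie outside a member of `U`.
    refine ⟨r fun i => if hi : ∃ x, P i x then hi.choose else Classical.arbitrary _,
      (hp _).2 (H.mono fun i hi => ?_)⟩
    simp only [dif_pos hi]
    exact hi.choose_spec

theorem exists_iff [∀ i, Nonempty (X i)] (h : IsUltra U q) {p : Y → Prop}
    {P : ∀ i, X i → Prop} (hp : ∀ k, p (q k) ↔ ∀ᶠ i in U, P i (k i)) :
    (∃ y, p y) ↔ ∀ᶠ i in U, ∃ x, P i x :=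
  exists_iff_of_surjective h.surj hp

/-- De Morgan dual of `exists_iff`, available because an ultrafilter commutes with negation. -/
theorem forall_iff [∀ i, Nonempty (X i)] (h : IsUltra U q) {p : Y → Prop}
    {P : ∀ i, X i → Prop} (hp : ∀ k, p (q k) ↔ ∀ᶠ i in U, P i (k i)) :
    (∀ y, p y) ↔ ∀ᶠ i in U, ∀ x, P i x := by
  have := h.exists_iff (p := fun y => ¬ p y) (P := fun i x => ¬ P i x)
    fun k => by rw [hp, Ultrafilter.eventually_not]
  rw [← not_iff_not, not_forall, this, ← Ultrafilter.eventually_not]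
  simp only [not_forall]

theorem exists_tuple_iff [∀ i, Nonempty (X i)] (h : IsUltra U q) {κ : Type*}
    {p : (κ → Y) → Prop} {P : ∀ i, (κ → X i) → Prop}
    (hp : ∀ k, p (tuple q k) ↔ ∀ᶠ i in U, P i (k i)) :
    (∃ y, p y) ↔ ∀ᶠ i in U, ∃ x, P i x :=
  exists_iff_of_surjective (h.tuple_surjective κ) hp

end IsUltra

/-! ### Compatibility of `tuple` with extending contexts -/

section tuple

variable {ι : Type u} {X : ι → Type u} {Y : Type u} (q : (∀ i, X i) → Y)

theorem tuple_snoc {n : ℕ} (k : ∀ i, Fin n → X i) (a : ∀ i, X i) :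
    (Fin.snoc (tuple q k) (q a) : Fin (n + 1) → Y)
      = tuple q fun i => (Fin.snoc (k i) (a i) : Fin (n + 1) → X i) := by
  funext c
  cases c using Fin.lastCases <;> simp [tuple]

theorem tuple_cons {n : ℕ} (k : ∀ i, Fin n → X i) (a : ∀ i, X i) :
    (Fin.cons (q a) (tuple q k) : Fin (n + 1) → Y)
      = tuple q fun i => (Fin.cons (a i) (k i) : Fin (n + 1) → X i) := by
  funext c
  cases c using Fin.cases <;> simp [tuple]

theorem tuple_sumElim {α β : Type*} (k : ∀ i, α → X i) (k' : ∀ i, β → X i) :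
    Sum.elim (tuple q k) (tuple q k') = tuple q fun i => Sum.elim (k i) (k' i) := by
  funext c
  cases c <;> rfl

theorem tuple_elim0 (k : ∀ i, Fin 0 → X i) : tuple q k = Fin.elim0 := funext fun c => c.elim0

end tuple

/-! ### The concrete ultraproduct of sets and its universal property -/

/-- The ultraproduct of a family of sets. -/
abbrev UProd {ι : Type u} (U : Ultrafilter ι) (X : ι → Type u) : Type u :=
  (U : Filter ι).Product X

namespace UProd

variable {ι : Type u} {U : Ultrafilter ι} {X : ι → Type u}

/-- The canonical projection from the full product. -/
def mk (U : Ultrafilter ι) (k : ∀ i, X i) : UProd U X := Quotient.mk _ k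

theorem isUltra_mk : IsUltra U (mk U (X := X)) :=
  ⟨Quotient.mk_surjective, fun _ _ => Quotient.eq⟩

open Classical in
/-- An arbitrary extension of a partial family. -/
noncomputable def extend [∀ i, Nonempty (X i)] {J : Set ι} (k : ∀ j : J, X j) (i : ι) : X i :=
  if h : i ∈ J then k ⟨i, h⟩ else Classical.arbitrary _

theorem extend_apply [∀ i, Nonempty (X i)] {J : Set ι} (k : ∀ j : J, X j) (j : J) :
    extend k (j : ι) = k j := dif_pos j.2

/-- The arbitrary values of `extend` outside `J` are invisible in the quotient, because `J ∈ U`. -/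
theorem mk_extend [∀ i, Nonempty (X i)] {J : Set ι} (hJ : J ∈ (U : Filter ι)) (k : ∀ j : J, X j)
    (k' : ∀ i, X i) (h : ∀ j : J, k j = k' j) : mk U (extend k) = mk U k' :=
  (isUltra_mk.eq_iff _ _).2 <| Filter.mem_of_superset hJ fun i hi =>
    (extend_apply k ⟨i, hi⟩).trans (h ⟨i, hi⟩)

/-- A compatible family of maps on the products over the members of `U` factors through the
ultraproduct. -/
def desc {Y : Type u} (c : ∀ J : {J : Set ι // J ∈ (U : Filter ι)}, (∀ j : J.1, X j) → Y)
    (hc : ∀ J (k : ∀ i, X i), c J (fun j => k j) = c ⟨Set.univ, Filter.univ_mem⟩ (fun j => k j)) :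
    UProd U X → Y :=
  Quotient.lift (fun k => c ⟨Set.univ, Filter.univ_mem⟩ (fun j => k j)) fun k k' h => by
    -- The set on which `k` and `k'` agree is in `U`, and on it their restrictions coincide, so both
    -- values are computed by the component at that set.
    rw [← hc ⟨_, h⟩ k, ← hc ⟨_, h⟩ k']
    exact congrArg (c ⟨_, h⟩) (funext fun j => j.2)

theorem desc_mk {Y : Type u} (c : ∀ J : {J : Set ι // J ∈ (U : Filter ι)}, (∀ j : J.1, X j) → Y)
    (hc : ∀ J (k : ∀ i, X i), c J (fun j => k j) = c ⟨Set.univ, Filter.univ_mem⟩ (fun j => k j)) (J)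
    (k : ∀ i, X i) : desc c hc (mk U k) = c J (fun j => k j) := (hc J k).symm

theorem desc_mk_extend [∀ i, Nonempty (X i)] {Y : Type u}
    (c : ∀ J : {J : Set ι // J ∈ (U : Filter ι)}, (∀ j : J.1, X j) → Y)
    (hc : ∀ J (k : ∀ i, X i), c J (fun j => k j) = c ⟨Set.univ, Filter.univ_mem⟩ (fun j => k j)) (J)
    (k : ∀ j : J.1, X j) : desc c hc (mk U (extend k)) = c J k := by
  rw [desc_mk c hc J]
  exact congrArg (c J) (funext fun j => extend_apply k j)

end UProd

/-! ## Filtered products from explicit data -/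

section

variable {C : Type (u + 1)} [Category.{u} C] {ι : Type u} {F : Filter ι} {M : ι → C}

theorem ProductSystem.hom_ext (A : ProductSystem F M) {J : {J : Set ι // J ∈ F}} {X : C}
    (f g : X ⟶ A.prod J) (h : ∀ i, f ≫ A.proj J i = g ≫ A.proj J i) : f = g :=
  Limits.Fan.IsLimit.hom_ext (A.isProd J) _ _ h

theorem ProductSystem.diagram_map_proj (A : ProductSystem F M) {J J' : {J : Set ι // J ∈ F}ᵒᵖ}
    (f : J ⟶ J') (i : J'.unop.1) :
    A.diagram.map f ≫ A.proj J'.unop i = A.proj J.unop ⟨i.1, leOfHom f.unop i.2⟩ :=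
  Limits.Fan.IsLimit.fac (A.isProd J'.unop) _ i

/-- A family of morphisms on the products over the members of `F` that is compatible with all
restriction maps. -/
def ProductSystem.Compatible (A : ProductSystem F M) {X : C} (c : ∀ J, A.prod J ⟶ X) : Prop :=
  ∀ (J J' : {J : Set ι // J ∈ F}) (h : J'.1 ⊆ J.1) (r : A.prod J ⟶ A.prod J'),
    (∀ i : J'.1, r ≫ A.proj J' i = A.proj J ⟨i.1, h i.2⟩) → r ≫ c J' = c J

/-- A filtered product from a universal compatible family. -/
def ProductSystem.filteredProduct (A : ProductSystem F M) (N : C) (μ : ∀ J, A.prod J ⟶ N)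
    (hμ : A.Compatible μ)
    (desc : ∀ {X : C} (c : ∀ J, A.prod J ⟶ X), A.Compatible c → (N ⟶ X))
    (fac : ∀ {X : C} (c : ∀ J, A.prod J ⟶ X) (hc : A.Compatible c) (J), μ J ≫ desc c hc = c J)
    (uniq : ∀ {X : C} (d d' : N ⟶ X), (∀ J, μ J ≫ d = μ J ≫ d') → d = d') :
    FilteredProduct F M :=
  have key : ∀ s : Limits.Cocone A.diagram, A.Compatible fun J => s.ι.app (op J) :=
    fun s J J' h r hr => by
      -- A morphism into a product is determined by its projections, so `r` can only be the
      -- transition map; `Compatible` is thus exactly the cocone condition.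
      have : r = A.diagram.map (homOfLE h : J' ⟶ J).op :=
        A.hom_ext _ _ fun i => (hr i).trans (A.diagram_map_proj (homOfLE h : J' ⟶ J).op i).symm
      rw [this]
      exact s.w _
  { A with
    cocone :=
      { pt := N
        ι :=
          { app := fun J => μ J.unop
            naturality := fun J J' f =>
              (hμ J.unop J'.unop (leOfHom f.unop) _ (A.diagram_map_proj f)).trans
                (Category.comp_id _).symm } }
    isColimit :=
      { desc := fun s => desc _ (key s)
        fac := fun s J => fac _ (key s) J.unop
        uniq := fun s m hm => uniq _ _ fun J => (hm (op J)).trans (fac _ (key s) J).symm } }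

/-- The canonical isomorphism between the products of two systems. -/
def ProductSystem.prodIso (A B : ProductSystem F M) (J : {J : Set ι // J ∈ F}) :
    A.prod J ≅ B.prod J :=
  Limits.IsLimit.conePointUniqueUpToIso (A.isProd J) (B.isProd J)

theorem ProductSystem.prodIso_hom_proj (A B : ProductSystem F M) (J : {J : Set ι // J ∈ F})
    (i : J.1) : (A.prodIso B J).hom ≫ B.proj J i = A.proj J i :=
  Limits.IsLimit.conePointUniqueUpToIso_hom_comp (A.isProd J) (B.isProd J) ⟨i⟩

/-- The canonical isomorphism between the diagrams of two product systems. -/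
def ProductSystem.diagramIso (A B : ProductSystem F M) : A.diagram ≅ B.diagram :=
  NatIso.ofComponents (fun J => A.prodIso B J.unop) fun {J J'} f =>
    B.hom_ext (J := J'.unop) (X := A.prod J.unop) (A.diagram.map f ≫ (A.prodIso B J'.unop).hom)
      ((A.prodIso B J.unop).hom ≫ B.diagram.map f) fun i =>
      (Category.assoc _ _ _).trans <| (congrArg (A.diagram.map f ≫ ·)
        (A.prodIso_hom_proj B J'.unop i)).trans <| (A.diagram_map_proj f i).trans <|
        (A.prodIso_hom_proj B J.unop _).symm.trans <| (congrArg ((A.prodIso B J.unop).hom ≫ ·)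
          (B.diagram_map_proj f i).symm).trans (Category.assoc _ _ _).symm

/-- Filtered products are unique up to isomorphism. -/
def FilteredProduct.ptIso (A B : FilteredProduct F M) : A.cocone.pt ≅ B.cocone.pt :=
  Limits.IsColimit.coconePointsIsoOfNatIso A.isColimit B.isColimit
    (A.diagramIso B.toProductSystem)

/-- The canonical morphism from the product over a member of the filter. -/
def FilteredProduct.incl (A : FilteredProduct F M) (J : {J : Set ι // J ∈ F}) :
    A.prod J ⟶ A.cocone.pt :=
  A.cocone.ι.app (op J)

theorem FilteredProduct.incl_ptIso_hom (A B : FilteredProduct F M) (J : {J : Set ι // J ∈ F}) :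
    A.incl J ≫ (A.ptIso B).hom = (A.prodIso B.toProductSystem J).hom ≫ B.incl J :=
  Limits.IsColimit.comp_coconePointsIsoOfNatIso_hom A.isColimit B.isColimit
    (A.diagramIso B.toProductSystem) (op J)

end

/-! ## Stratified institutions with the Łoś property -/

/-- For all families of models there is a filtered product for which the Łoś theorem holds,
satisfaction is invariant under isomorphisms, and negations are available. -/
structure StratInst.IsLos (I : StratInst.{u}) : Prop where
  iso : ∀ {S : I.Sign} {M N : I.Mod.obj (op S)} (e : M ≅ N) (w : (I.st S).obj M)
    (ρ : I.Sen.obj S), I.Sat M w ρ ↔ I.Sat N ((I.st S).map e.hom w) ρ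
  nonempty : ∀ {S : I.Sign} (M : I.Mod.obj (op S)), Nonempty ((I.st S).obj M)
  neg : ∀ {S : I.Sign} (ρ : I.Sen.obj S), ∃ ρ' : I.Sen.obj S,
    ∀ (M : I.Mod.obj (op S)) (w : (I.st S).obj M), I.Sat M w ρ' ↔ ¬ I.Sat M w ρ
  surj : I.StSurjective
  ultra : ∀ {S : I.Sign} {ι : Type u} (U : Ultrafilter ι) (M : ι → I.Mod.obj (op S)),
    ∃ (B : FilteredProduct (U : Filter ι) M)
      (q : (∀ i, (I.st S).obj (M i)) → (I.st S).obj B.cocone.pt),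
      Function.Surjective q ∧
      (∀ J (k' : (I.st S).obj (B.prod J)) (k : ∀ i, (I.st S).obj (M i)),
        (∀ j : J.1, (I.st S).map (B.proj J j) k' = k j) →
          (I.st S).map (B.incl J) k' = q k) ∧
      (∀ (J : {J : Set ι // J ∈ (U : Filter ι)}) (k : ∀ i, (I.st S).obj (M i)),
        ∃ k' : (I.st S).obj (B.prod J), ∀ j : J.1, (I.st S).map (B.proj J j) k' = k j) ∧
      ∀ (k : ∀ i, (I.st S).obj (M i)) (ρ : I.Sen.obj S),
        I.Sat B.cocone.pt (q k) ρ ↔ ∀ᶠ i in U, I.Sat (M i) (k i) ρ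

namespace StratInst.IsLos

variable {I : StratInst.{u}}

/-- Each clause concerns a single signature or a single signature morphism, and the data of the
restricted institution at `s` are those of `I` at `Φ.obj s`. -/
theorem pullback (h : I.IsLos) {T : Type (u + 1)} [Category.{u} T] (Φ : T ⥤ I.Sign) :
    (I.pullback Φ).IsLos where
  iso := fun {S} => h.iso (S := Φ.obj S)
  nonempty := fun {S} => h.nonempty (S := Φ.obj S)
  neg := fun {S} => h.neg (S := Φ.obj S)
  surj := fun φ => h.surj (Φ.map φ)
  ultra := fun {S} => h.ultra (S := Φ.obj S)

theorem hasUltraproducts (h : I.IsLos) : I.HasUltraproducts := fun _ _ U M =>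
  let ⟨B, _⟩ := h.ultra U M
  ⟨B⟩

/-- The given ultraproduct `A` is compared with the distinguished one `B`, for which Łoś is known.
The isomorphisms of the products and of the colimits commute with projections and with colimit
injections, and satisfaction is transported along them. -/
theorem sat_iff_factorSat (h : I.IsLos) {S : I.Sign} (ρ : I.Sen.obj S) {ι : Type u}
    {U : Ultrafilter ι} {M : ι → I.Mod.obj (op S)} (A : FilteredProduct (U : Filter ι) M)
    (w : (I.st S).obj A.cocone.pt) : I.Sat A.cocone.pt w ρ ↔ I.FactorSat A w ρ := by
  obtain ⟨B, q, hq, hμ, hpr, hlos⟩ := h.ultra U M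
  have hproj : ∀ J k (j : J.1), (I.st S).map (B.proj J j)
      ((I.st S).map (A.prodIso B.toProductSystem J).hom k) = (I.st S).map (A.proj J j) k := by
    intro J k j
    rw [← Functor.map_comp_apply, A.prodIso_hom_proj]
  have hι : ∀ J k, (I.st S).map (A.ptIso B).hom ((I.st S).map (A.incl J) k)
      = (I.st S).map (B.incl J)
          ((I.st S).map (A.prodIso B.toProductSystem J).hom k) := by
    intro J k
    rw [← Functor.map_comp_apply, ← Functor.map_comp_apply, A.incl_ptIso_hom]
  rw [h.iso (A.ptIso B)]
  have : ∀ i, Nonempty ((I.st S).obj (M i)) := fun i => h.nonempty _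
  constructor
  · intro H
    obtain ⟨k, hk⟩ := hq ((I.st S).map (A.ptIso B).hom w)
    rw [← hk, hlos] at H
    -- By Łoś the set of indices where `ρ` holds along `k` belongs to `U`; this set is the `J` of
    -- (∗), and the restriction of `k` to it, moved back to the product in `A`, is the required
    -- state.
    obtain ⟨k', hk'⟩ := hpr ⟨_, H⟩ k
    let K := (I.st S).map (A.prodIso B.toProductSystem ⟨_, H⟩).inv k'
    have hK : (I.st S).map (A.prodIso B.toProductSystem ⟨_, H⟩).hom K = k' :=
      Iso.inv_hom_id_apply ((I.st S).mapIso (A.prodIso B.toProductSystem ⟨_, H⟩)) k'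
    refine ⟨⟨_, H⟩, K, ?_, fun j => ?_⟩
    · have := (hι ⟨_, H⟩ K).trans ((congrArg _ hK).trans ((hμ _ k' k hk').trans hk))
      exact ((I.st S).mapIso (A.ptIso B)).toEquiv.injective this
    · rw [← hproj, hK, hk']
      exact j.2
  · rintro ⟨J, k, rfl, hk⟩
    change I.Sat B.cocone.pt ((I.st S).map (A.ptIso B).hom ((I.st S).map (A.incl J) k)) ρ
    -- Łoś is stated for full families, so the projections of `k` are extended arbitrarily beyond
    -- `J`; this is where non-emptiness of the state sets enters.
    rw [hι, hμ J _ (UProd.extend fun j => (I.st S).map (A.proj J j) k), hlos]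
    · refine Filter.mem_of_superset J.2 fun i hi => ?_
      have := hk ⟨i, hi⟩
      rw [← UProd.extend_apply (X := fun i => (I.st S).obj (M i))
        (fun j : J.1 => (I.st S).map (A.proj J j) k) ⟨i, hi⟩] at this
      exact this
    · intro j
      rw [UProd.extend_apply (X := fun i => (I.st S).obj (M i)), hproj]

/-! ### Compactness -/

/-- An ultrafilter on the finite subsets of `E` that contains all the sets `{s | x ∈ s}`. -/
theorem exists_ultrafilter_finset (E : Type u) :
    ∃ U : Ultrafilter (Finset E), ∀ x, ∀ᶠ s : Finset E in U, x ∈ s := by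
  classical
  refine ⟨Ultrafilter.of Filter.atTop, fun x => Ultrafilter.of_le _ ?_⟩
  exact (Filter.eventually_ge_atTop {x}).mono fun s hs => hs (Finset.mem_singleton_self x)

theorem finset_image_subset {α : Type u} {E : Set α} (s : Finset E) :
    (Subtype.val '' (s : Set E)) ⊆ E ∧ (Subtype.val '' (s : Set E)).Finite :=
  ⟨by rintro _ ⟨x, _, rfl⟩; exact x.2, s.finite_toSet.image _⟩

/-- Take the ultraproduct of models `M s` of the finite subsets `s` of `E`, at the state represented
by their distinguished states. A given `ρ ∈ E` holds at every `s` containing it, hence almost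
everywhere. -/
theorem sharp_mCompact (h : I.IsLos) : I.sharp.MCompact := by
  intro S E
  refine ⟨fun ⟨M, hM⟩ E₀ h₀ _ => ⟨M, fun ρ hρ => hM ρ (h₀ hρ)⟩, fun H => ?_⟩
  obtain ⟨U, hU⟩ := exists_ultrafilter_finset E
  choose M hM using fun s : Finset E =>
    H _ (finset_image_subset s).1 (finset_image_subset s).2
  obtain ⟨B, q, -, -, -, hlos⟩ := h.ultra U fun s => (M s).1
  refine ⟨⟨B.cocone.pt, q fun s => (M s).2⟩, fun ρ hρ => (hlos _ ρ).2 ?_⟩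
  exact (hU ⟨ρ, hρ⟩).mono fun s hs => hM s ρ ⟨_, hs, rfl⟩

/-- Same ultraproduct as in the local case. Surjectivity of `q` represents an arbitrary state of it
by a family of states, and global satisfaction in the factors covers every such family. -/
theorem star_mCompact (h : I.IsLos) : (I.star h.surj).MCompact := by
  intro S E
  refine ⟨fun ⟨M, hM⟩ E₀ h₀ _ => ⟨M, fun ρ hρ => hM ρ (h₀ hρ)⟩, fun H => ?_⟩
  obtain ⟨U, hU⟩ := exists_ultrafilter_finset E
  choose M hM using fun s : Finset E =>
    H _ (finset_image_subset s).1 (finset_image_subset s).2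
  obtain ⟨B, q, hq, -, -, hlos⟩ := h.ultra U M
  refine ⟨B.cocone.pt, fun ρ hρ w => ?_⟩
  obtain ⟨k, rfl⟩ := hq w
  exact (hlos _ ρ).2 ((hU ⟨ρ, hρ⟩).mono fun s hs => hM s ρ ⟨_, hs, rfl⟩ _)

/-- If no finite part of `E` entails `ρ`, then `E` together with a negation of `ρ` is finitely
satisfiable, hence satisfiable. The argument is local: negation is complementary at a fixed state,
not for truth at all states. -/
theorem sharp_compact (h : I.IsLos) : I.sharp.Compact := by
  intro S E ρ hE
  obtain ⟨ρ', hρ'⟩ := h.neg ρ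
  by_contra! hcon
  obtain ⟨M, hM⟩ := (h.sharp_mCompact S (insert ρ' E)).2 fun E₀ h₀ hfin => by
    -- Deleting `ρ'` leaves a finite subset of `E`; a pointed model of it that refutes `ρ`
    -- automatically satisfies `ρ'`.
    obtain ⟨M, hM, hMρ⟩ := Set.not_subset.1 (hcon (E₀ \ {ρ'})
      (fun σ hσ => (h₀ hσ.1).resolve_left hσ.2) hfin.sdiff)
    refine ⟨M, fun σ hσ => ?_⟩
    by_cases hs : σ = ρ'
    · subst hs
      refine (hρ' M.1 M.2).2 fun hsat => hMρ ?_
      rintro _ rfl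
      exact hsat
    · exact hM σ ⟨hσ, hs⟩
  exact (hρ' M.1 M.2).1 (hM ρ' (Set.mem_insert _ _))
    (hE (fun σ hσ => hM σ (Set.mem_insert_of_mem _ hσ)) ρ rfl)

end StratInst.IsLos

/-! ### Restriction from the full product, one-point ultraproducts, and representatives -/

theorem ProductSystem.Compatible.exists_restrict {C : Type (u + 1)} [Category.{u} C] {ι : Type u}
    {F : Filter ι} {M : ι → C} {A : ProductSystem F M} {X : C} {c : ∀ J, A.prod J ⟶ X}
    (hc : A.Compatible c) (J : {J : Set ι // J ∈ F}) :
    ∃ r : A.prod ⟨Set.univ, Filter.univ_mem⟩ ⟶ A.prod J,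
      (∀ i : J.1, r ≫ A.proj J i = A.proj ⟨Set.univ, Filter.univ_mem⟩ ⟨i.1, trivial⟩) ∧
        r ≫ c J = c ⟨Set.univ, Filter.univ_mem⟩ :=
  let f : J ⟶ ⟨Set.univ, Filter.univ_mem⟩ := homOfLE (Set.subset_univ J.1)
  ⟨A.diagram.map f.op, A.diagram_map_proj f.op,
    hc _ J (Set.subset_univ _) _ (A.diagram_map_proj f.op)⟩

/-- A bijection is an ultraproduct projection over a one-point index set. Invariance of satisfaction
under isomorphism thereby becomes a special case of Łoś, with no separate induction on formulas. -/
theorem isUltra_pure {X Y : Type u} {e : X → Y} (he : Function.Bijective e) :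
    IsUltra (pure PUnit.unit : Ultrafilter PUnit.{u + 1}) fun k : PUnit → X => e (k ⟨⟩) where
  surj y := (he.2 y).imp' (fun x _ => x) fun _ h => h
  eq_iff k k' := by simp [he.1.eq_iff]

namespace UProd

variable {ι : Type u} {U : Ultrafilter ι} {X : ι → Type u}

/-- A representing family of an element of the ultraproduct. -/
noncomputable def rep (x : UProd U X) : ∀ i, X i := Quotient.out x

theorem mk_rep (x : UProd U X) : mk U x.rep = x := Quotient.out_eq x

theorem mk_extend_univ [∀ i, Nonempty (X i)] (k : ∀ i, X i) :
    mk U (extend fun j : Set.univ => k j) = mk U k :=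
  mk_extend Filter.univ_mem _ k fun _ => rfl

theorem rep_mk (k : ∀ i, X i) : ∀ᶠ i in U, (mk U k).rep i = k i :=
  (isUltra_mk.eq_iff _ _).1 (mk_rep _)

theorem rep_tuple {κ : Type*} [Finite κ] (k : ∀ i, κ → X i) :
    ∀ᶠ i in U, (fun c => (tuple (mk U) k c).rep i) = k i := by
  simp only [funext_iff, Filter.eventually_all]
  exact fun c => rep_mk _

/-- Relations on the concrete ultraproducts are defined through chosen representatives; this
replaces the chosen one by any other. The version for tuples requires finite `κ`. -/
theorem eventually_rep_mk (k : ∀ i, X i) (p : ∀ i, X i → Prop) :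
    (∀ᶠ i in U, p i ((mk U k).rep i)) ↔ ∀ᶠ i in U, p i (k i) :=
  Filter.eventually_congr ((rep_mk k).mono fun _ h => by rw [h])

theorem eventually_rep_tuple {κ : Type*} [Finite κ] (k : ∀ i, κ → X i)
    (p : ∀ i, (κ → X i) → Prop) :
    (∀ᶠ i in U, p i fun c => (tuple (mk U) k c).rep i) ↔ ∀ᶠ i in U, p i (k i) :=
  Filter.eventually_congr ((rep_tuple k).mono fun _ h => by rw [h])

end UProd

/-! ## Ultraproducts of frames -/

namespace Frame

variable {S : FrameSig.{u}}

attribute [instance] Frame.ne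

/-- `q` exhibits `N` as the ultraproduct of the frames `M i`. -/
structure IsUltra {ι : Type u} (U : Ultrafilter ι) (M : ι → Frame S) (N : Frame S)
    (q : (∀ i, (M i).W) → N.W) : Prop extends Strat.IsUltra U q where
  nom : ∀ n, N.nom n = q fun i => (M i).nom n
  rel : ∀ {n : ℕ} (l : S.Mdl n) (v : ∀ i, Fin n → (M i).W),
    tuple q v ∈ N.rel l ↔ ∀ᶠ i in U, v i ∈ (M i).rel l

theorem IsUltra.nom_elim {ι : Type u} {U : Ultrafilter ι} {M : ι → Frame S} {N : Frame S}
    {q : (∀ i, (M i).W) → N.W} (h : IsUltra U M N q) {k : ℕ} (v : ∀ i, Fin k → (M i).W)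
    (n : S.Nom ⊕ Fin k) :
    Sum.elim N.nom (tuple q v) n = q fun i => Sum.elim (M i).nom (v i) n := by
  cases n
  · exact h.nom _
  · rfl

/-- Relations must be reflected as well as preserved, and reflection along `f` is preservation along
`g`. -/
theorem isUltra_of_inverse {M N : Frame S} (f : M ⟶ N) (g : N ⟶ M)
    (hgf : ∀ x, g.toFun (f.toFun x) = x) (hfg : ∀ y, f.toFun (g.toFun y) = y) :
    IsUltra (pure PUnit.unit : Ultrafilter PUnit.{u + 1}) (fun _ => M) N
      fun k => f.toFun (k ⟨⟩) where
  toIsUltra := isUltra_pure <| Function.bijective_iff_has_inverse.2 ⟨g.toFun, hgf, hfg⟩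
  nom n := (f.map_nom n).symm
  rel l v := by
    simp only [Ultrafilter.coe_pure, Filter.eventually_pure]
    refine ⟨fun h => ?_, fun h => f.map_rel l _ h⟩
    have := g.map_rel l _ h
    have hv : g.toFun ∘ tuple (fun k : PUnit → M.W => f.toFun (k ⟨⟩)) v = v ⟨⟩ :=
      funext fun c => hgf _
    rwa [hv] at this

theorem isUltra_of_iso {M N : Frame S} (e : M ≅ N) :
    IsUltra (pure PUnit.unit : Ultrafilter PUnit.{u + 1}) (fun _ => M) N
      fun k => e.hom.toFun (k ⟨⟩) :=
  isUltra_of_inverse e.hom e.inv (congrFun (congrArg Hom.toFun e.hom_inv_id))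
    (congrFun (congrArg Hom.toFun e.inv_hom_id))

/-- The direct product. -/
def pi {κ : Type u} (M : κ → Frame S) : Frame S where
  W := ∀ j, (M j).W
  nom n j := (M j).nom n
  rel l := {v | ∀ j, (fun a => v a j) ∈ (M j).rel l}

def proj {κ : Type u} (M : κ → Frame S) (j : κ) : pi M ⟶ M j where
  toFun k := k j
  map_nom _ := rfl
  map_rel _ _ h := h j

def lift {κ : Type u} {M : κ → Frame S} {N : Frame S} (f : ∀ j, N ⟶ M j) : N ⟶ pi M where
  toFun x j := (f j).toFun x
  map_nom n := funext fun j => (f j).map_nom n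
  map_rel l v h j := (f j).map_rel l v h

variable {ι : Type u} {U : Ultrafilter ι}

/-- The ultraproduct. -/
noncomputable def ultra (U : Ultrafilter ι) (M : ι → Frame S) : Frame S where
  W := UProd U fun i => (M i).W
  ne := ⟨UProd.mk U fun _ => Classical.arbitrary _⟩
  nom n := UProd.mk U fun i => (M i).nom n
  rel l := {y | ∀ᶠ i in U, (fun a => (y a).rep i) ∈ (M i).rel l}

theorem isUltra_ultra (U : Ultrafilter ι) (M : ι → Frame S) :
    IsUltra U M (ultra U M) (UProd.mk U) where
  toIsUltra := UProd.isUltra_mk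
  nom _ := rfl
  rel l v := UProd.eventually_rep_tuple v fun i x => x ∈ (M i).rel l

variable {M : ι → Frame S}

/-- The canonical homomorphism from the product over a member of `U`. -/
noncomputable def incl (M : ι → Frame S) (J : {J : Set ι // J ∈ (U : Filter ι)}) :
    pi (fun j : J.1 => M j) ⟶ ultra U M where
  toFun k := UProd.mk U (UProd.extend k)
  map_nom n := UProd.mk_extend (X := fun i => (M i).W) J.2 _ (fun i => (M i).nom n) fun _ => rfl
  map_rel l v h := ((isUltra_ultra U M).rel l fun i a =>
      UProd.extend (X := fun i => (M i).W) (v a) i).2 <|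
    Filter.mem_of_superset J.2 fun i hi => by
      have := h ⟨i, hi⟩
      rwa [← funext fun a => UProd.extend_apply (X := fun i => (M i).W) (v a) ⟨i, hi⟩] at this

/-- The homomorphism induced on the ultraproduct by a compatible family. -/
def desc {N : Frame S}
    (c : ∀ J : {J : Set ι // J ∈ (U : Filter ι)}, pi (fun j : J.1 => M j) ⟶ N)
    (hc : ∀ J (k : ∀ i, (M i).W), (c J).toFun (fun j => k j)
      = (c ⟨Set.univ, Filter.univ_mem⟩).toFun fun j => k j) : ultra U M ⟶ N where
  toFun := UProd.desc (fun J => (c J).toFun) hc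
  map_nom n := (c ⟨Set.univ, Filter.univ_mem⟩).map_nom n
  map_rel l v h := by
    obtain ⟨v, rfl⟩ := (isUltra_ultra U M).tuple_surjective _ v
    rw [(isUltra_ultra U M).rel] at h
    -- The relation need not hold in all factors, so the full product is of no use; over the set
    -- where it does hold, the restricted tuple is related in the product and the component of the
    -- cocone there applies.
    have := (c ⟨_, h⟩).map_rel l (fun a j => v j a) fun j => j.2
    have hv : UProd.desc (fun J => (c J).toFun) hc ∘ tuple (UProd.mk U) v
        = (c ⟨_, h⟩).toFun ∘ fun a j => v j a :=
      funext fun a => UProd.desc_mk _ hc ⟨_, h⟩ _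
    rwa [← hv] at this

end Frame

/-! ## Propositional Kripke logics -/

namespace PModel

variable {S : PSig.{u}}

/-- `q` exhibits `N` as the ultraproduct of the Kripke structures `M i`. -/
structure IsUltra {ι : Type u} (U : Ultrafilter ι) (M : ι → PModel S) (N : PModel S)
    (q : (∀ i, (M i).frame.W) → N.frame.W) : Prop where
  frame : Frame.IsUltra U (fun i => (M i).frame) N.frame q
  val : ∀ (k : ∀ i, (M i).frame.W) (p : S.2), p ∈ N.val (q k) ↔ ∀ᶠ i in U, p ∈ (M i).val (k i)

end PModel

/-- The Łoś theorem. -/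
theorem PForm.sat_iff_eventually {hyb : Bool} {S : PSig.{u}} {ι : Type u} {U : Ultrafilter ι}
    {M : ι → PModel S} {N : PModel S} {q : (∀ i, (M i).frame.W) → N.frame.W}
    (h : PModel.IsUltra U M N q) {k : ℕ} (ρ : PForm hyb S.1 S.2 k)
    (v : ∀ i, Fin k → (M i).frame.W) (w : ∀ i, (M i).frame.W) :
    Sat N ρ (tuple q v) (q w) ↔ ∀ᶠ i in U, Sat (M i) ρ (v i) (w i) := by
  induction ρ generalizing w with
  | atom p => exact h.val w p
  | and ρ σ h1 h2 => simp only [Sat, Filter.eventually_and, h1, h2]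
  | neg ρ h1 => simp only [Sat, Ultrafilter.eventually_not, h1]
  | poss l ρ h1 =>
    -- The successors form one tuple of worlds, quantified in a single step; as the modality has
    -- finite arity, the conditions on them hold simultaneously almost everywhere.
    refine h.frame.exists_tuple_iff fun u => ?_
    rw [tuple_cons, h.frame.rel, Filter.eventually_and, Filter.eventually_all]
    exact and_congr Iff.rfl (forall_congr' fun a => h1 a v fun i => u i a)
  | nom hh n => simp only [Sat, h.frame.nom_elim, h.frame.eq_iff]
  | sat hh n ρ h1 => simp only [Sat, h.frame.nom_elim, h1]
  | exNom hh ρ h1 =>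
    refine h.frame.exists_iff fun a => ?_
    rw [tuple_snoc, h1]

theorem PForm.sentence_sat_iff_eventually {hyb : Bool} {S : PSig.{u}} {ι : Type u}
    {U : Ultrafilter ι} {M : ι → PModel S} {N : PModel S} {q : (∀ i, (M i).frame.W) → N.frame.W}
    (h : PModel.IsUltra U M N q) (ρ : PForm hyb S.1 S.2 0) (w : ∀ i, (M i).frame.W) :
    Sat N ρ Fin.elim0 (q w) ↔ ∀ᶠ i in U, Sat (M i) ρ Fin.elim0 (w i) := by
  rw [← sat_iff_eventually h, tuple_elim0]

namespace PModel

variable {S : PSig.{u}}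

theorem isUltra_of_inverse {M N : PModel S} (f : M ⟶ N) (g : N ⟶ M)
    (hgf : ∀ x, g.frame.toFun (f.frame.toFun x) = x)
    (hfg : ∀ y, f.frame.toFun (g.frame.toFun y) = y) :
    IsUltra (pure PUnit.unit : Ultrafilter PUnit.{u + 1}) (fun _ => M) N
      fun k => f.frame.toFun (k ⟨⟩) where
  frame := Frame.isUltra_of_inverse f.frame g.frame hgf hfg
  val k p := by
    simp only [Ultrafilter.coe_pure, Filter.eventually_pure]
    refine ⟨fun h => ?_, fun h => f.map_val _ h⟩
    have := g.map_val _ h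
    rwa [hgf] at this

theorem isUltra_of_iso {M N : PModel S} (e : M ≅ N) :
    IsUltra (pure PUnit.unit : Ultrafilter PUnit.{u + 1}) (fun _ => M) N
      fun k => e.hom.frame.toFun (k ⟨⟩) :=
  isUltra_of_inverse e.hom e.inv (congrFun (congrArg (fun f => f.frame.toFun) e.hom_inv_id))
    (congrFun (congrArg (fun f => f.frame.toFun) e.inv_hom_id))

variable {ι : Type u} {U : Ultrafilter ι}

/-- The system of direct products of a family of Kripke structures. -/
def productSystem (F : Filter ι) (M : ι → PModel S) : ProductSystem F M where
  prod J := ⟨Frame.pi fun j : J.1 => (M j).frame, fun w => {p | ∀ j : J.1, p ∈ (M j).val (w j)}⟩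
  proj J i := ⟨Frame.proj (fun j : J.1 => (M j).frame) i, fun _ _ hp => hp i⟩
  isProd J := Limits.Fan.IsLimit.mk _
    (fun s => ⟨Frame.lift fun j => (s.proj j).frame, fun w _ hp (j : J.1) => (s.proj j).map_val w hp⟩)
    (fun _ _ => rfl)
    (fun s m hm => by
      refine Hom.ext (Frame.Hom.ext (funext fun x => funext fun j => ?_))
      exact congrFun (congrArg (fun f => f.frame.toFun) (hm j)) x)

/-- The ultraproduct. -/
noncomputable def ultra (U : Ultrafilter ι) (M : ι → PModel S) : PModel S where
  frame := Frame.ultra U fun i => (M i).frame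
  val w := {p | ∀ᶠ i in U, p ∈ (M i).val (UProd.rep w i)}

theorem isUltra_ultra (U : Ultrafilter ι) (M : ι → PModel S) :
    IsUltra U M (ultra U M) (UProd.mk U) where
  frame := Frame.isUltra_ultra U _
  val k p := UProd.eventually_rep_mk k fun i x => p ∈ (M i).val x

/-- Supplies the hypothesis of `UProd.desc`. The morphism from the full product to the product over
`J` is known only through its projections, but these evaluate coordinates, so on worlds it is
restriction of families. -/
theorem compatible_frame {M : ι → PModel S} {N : PModel S}
    {c : ∀ J, (productSystem (U : Filter ι) M).prod J ⟶ N}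
    (hc : (productSystem (U : Filter ι) M).Compatible c) (J) (k : ∀ i, (M i).frame.W) :
    (c J).frame.toFun (fun j => k j)
      = (c ⟨Set.univ, Filter.univ_mem⟩).frame.toFun fun j => k j := by
  obtain ⟨r, hr, hrc⟩ := hc.exists_restrict J
  rw [← hrc]
  refine congrArg (c J).frame.toFun (funext fun j => ?_)
  exact (congrArg (fun f => f.frame.toFun fun j : Set.univ => k j) (hr j)).symm

noncomputable def filteredProduct (U : Ultrafilter ι) (M : ι → PModel S) :
    FilteredProduct (U : Filter ι) M :=
  (productSystem (U : Filter ι) M).filteredProduct (ultra U M)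
    (fun J => ⟨Frame.incl (fun i => (M i).frame) J, fun w p hp =>
      ((isUltra_ultra U M).val (UProd.extend w) p).2 <| Filter.mem_of_superset J.2 fun i hi => by
        have := hp ⟨i, hi⟩
        rwa [← UProd.extend_apply (X := fun i => (M i).frame.W) w ⟨i, hi⟩] at this⟩)
    (fun J J' h r hr => by
      refine Hom.ext (Frame.Hom.ext (funext fun k => ?_))
      refine UProd.mk_extend (X := fun i => (M i).frame.W) J'.2 _ _ fun j => ?_
      exact (congrFun (congrArg (fun f => f.frame.toFun) (hr j)) k).trans
        (UProd.extend_apply (X := fun i => (M i).frame.W) k ⟨j, h j.2⟩).symm)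
    (fun c hc => ⟨Frame.desc (fun J => (c J).frame) (compatible_frame hc), fun w p hp => by
      obtain ⟨k, rfl⟩ := (isUltra_ultra U M).frame.surj w
      rw [(isUltra_ultra U M).val] at hp
      have := (c ⟨_, hp⟩).map_val (fun j => k j) fun j : {i | p ∈ (M i).val (k i)} => j.2
      exact (congrArg (p ∈ PModel.val _ ·) (UProd.desc_mk (X := fun i => (M i).frame.W)
        (fun J => (c J).frame.toFun) (compatible_frame hc) ⟨_, hp⟩ k)).mpr this⟩)
    (fun c hc J => by
      refine Hom.ext (Frame.Hom.ext (funext fun k => ?_))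
      exact UProd.desc_mk_extend (X := fun i => (M i).frame.W) (fun J => (c J).frame.toFun)
        (compatible_frame hc) J k)
    -- Every world of the ultraproduct is the class of a full family, so the component at `Set.univ`
    -- already determines the morphism.
    (fun d d' h => by
      refine Hom.ext (Frame.Hom.ext (funext fun w => ?_))
      obtain ⟨k, rfl⟩ := (isUltra_ultra U M).frame.surj w
      rw [← UProd.mk_extend_univ k]
      exact congrArg (fun f => f.frame.toFun fun j : Set.univ => k j)
        (h ⟨Set.univ, Filter.univ_mem⟩))

end PModel

theorem kripkeProp_isLos (hyb : Bool) : (kripkeProp.{u} hyb).IsLos where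
  iso e w ρ :=
    ((PForm.sentence_sat_iff_eventually (PModel.isUltra_of_iso e) ρ fun _ => w).trans
      Filter.eventually_pure).symm
  nonempty M := M.frame.ne
  neg ρ := ⟨PForm.neg ρ, fun _ _ => Iff.rfl⟩
  surj _ _ w := ⟨w, rfl⟩
  ultra U M :=
    ⟨PModel.filteredProduct U M, UProd.mk U, (PModel.isUltra_ultra U M).frame.surj,
      fun J k' k h => UProd.mk_extend (X := fun i => (M i).frame.W) J.2 k' k h,
      fun _ k => ⟨fun j => k j, fun _ => rfl⟩,
      fun k ρ => PForm.sentence_sat_iff_eventually (PModel.isUltra_ultra U M) ρ k⟩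

/-! ## Ultraproducts of first-order structures -/

/-- `q` exhibits the structure `t` as the ultraproduct of the structures `s i`. -/
structure IsUltraStr {L : FOLSig.{u}} {ι : Type u} (U : Ultrafilter ι) {D : ι → Type u}
    {E : Type u} (q : (∀ i, D i) → E) (s : ∀ i, L.Structure (D i)) (t : L.Structure E) : Prop where
  funMap : ∀ {n : ℕ} (f : L.Functions n) (x : ∀ i, Fin n → D i),
    t.funMap f (tuple q x) = q fun i => (s i).funMap f (x i)
  relMap : ∀ {n : ℕ} (r : L.Relations n) (x : ∀ i, Fin n → D i),
    t.RelMap r (tuple q x) ↔ ∀ᶠ i in U, (s i).RelMap r (x i)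

/-- The direct product of structures. -/
abbrev piStr {L : FOLSig.{u}} {κ : Type u} {D : κ → Type u} (s : ∀ j, L.Structure (D j)) :
    L.Structure (∀ j, D j) where
  funMap f x j := (s j).funMap f fun a => x a j
  RelMap r x := ∀ j, (s j).RelMap r fun a => x a j

/-- The ultraproduct of structures. -/
noncomputable abbrev ultraStr {L : FOLSig.{u}} {ι : Type u} (U : Ultrafilter ι) {D : ι → Type u}
    (s : ∀ i, L.Structure (D i)) : L.Structure (UProd U D) where
  funMap f y := UProd.mk U fun i => (s i).funMap f fun a => (y a).rep i
  RelMap r y := ∀ᶠ i in U, (s i).RelMap r fun a => (y a).rep i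

section

variable {L : FOLSig.{u}} {ι : Type u} {U : Ultrafilter ι} {D : ι → Type u}

theorem isUltraStr_ultraStr (s : ∀ i, L.Structure (D i)) :
    IsUltraStr U (UProd.mk U) s (ultraStr U s) where
  funMap f x := (UProd.isUltra_mk.eq_iff _ _).2 <|
    (UProd.rep_tuple x).mono fun i h => congrArg ((s i).funMap f) h
  relMap r x := UProd.eventually_rep_tuple x fun i y => (s i).RelMap r y

/-- Needed for Kripke models: there the structure at a world is assembled along the chosen
representative of the world, which agrees with a given one only almost everywhere. -/
theorem IsUltraStr.congr {E : Type u} {q : (∀ i, D i) → E} (hq : IsUltra U q)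
    {s s' : ∀ i, L.Structure (D i)} {t : L.Structure E} (h : IsUltraStr U q s t)
    (hs : ∀ᶠ i in U, s i = s' i) : IsUltraStr U q s' t where
  funMap f x := (h.funMap f x).trans <| (hq.eq_iff _ _).2 <| hs.mono fun i hi => by rw [hi]
  relMap r x := (h.relMap r x).trans <| Filter.eventually_congr <| hs.mono fun i hi => by rw [hi]

theorem IsUltraStr.realize {E : Type u} {q : (∀ i, D i) → E}
    {s : ∀ i, L.Structure (D i)} {t : L.Structure E} (h : IsUltraStr U q s t) {α : Type*}
    (T : L.Term α) (v : ∀ i, α → D i) :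
    @FirstOrder.Language.Term.realize L E t α (tuple q v) T
      = q fun i => @FirstOrder.Language.Term.realize L (D i) (s i) α (v i) T := by
  induction T with
  | var => rfl
  | func f T ih =>
    simp only [FirstOrder.Language.Term.realize, ih]
    exact h.funMap f _

theorem IsUltraStr.relMap_realize {E : Type u} {q : (∀ i, D i) → E}
    {s : ∀ i, L.Structure (D i)} {t : L.Structure E} (h : IsUltraStr U q s t) {α : Type*} {n : ℕ}
    (r : L.Relations n) (T : Fin n → L.Term α) (v : ∀ i, α → D i) :
    (t.RelMap r fun j => @FirstOrder.Language.Term.realize L E t α (tuple q v) (T j))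
      ↔ ∀ᶠ i in U, (s i).RelMap r
          fun j => @FirstOrder.Language.Term.realize L (D i) (s i) α (v i) (T j) := by
  simp only [h.realize]
  exact h.relMap r fun i j => @FirstOrder.Language.Term.realize L (D i) (s i) α (v i) (T j)

theorem isUltraStr_of_inverse {D E : Type u} {s : L.Structure D} {t : L.Structure E} {h : D → E}
    {h' : E → D} (hh : IsFOHom s t h) (hh' : IsFOHom t s h') (hinv : ∀ x, h' (h x) = x) :
    IsUltraStr (pure PUnit.unit : Ultrafilter PUnit.{u + 1}) (fun k : PUnit → D => h (k ⟨⟩))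
      (fun _ => s) t where
  funMap f x := (hh.map_fun f (x ⟨⟩)).symm
  relMap r x := by
    simp only [Ultrafilter.coe_pure, Filter.eventually_pure]
    refine ⟨fun H => ?_, fun H => hh.map_rel r _ H⟩
    have := hh'.map_rel r _ H
    rwa [show h' ∘ tuple (fun k : PUnit → D => h (k ⟨⟩)) x = x ⟨⟩ from
      funext fun c => hinv _] at this

theorem isFOHom_eval {κ : Type u} {D : κ → Type u} (s : ∀ j, L.Structure (D j)) (j : κ) :
    IsFOHom (piStr s) (s j) fun k => k j :=
  ⟨fun _ _ => rfl, fun _ _ h => h j⟩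

theorem isFOHom_pi {κ : Type u} {D : κ → Type u} {s : ∀ j, L.Structure (D j)} {E : Type u}
    {t : L.Structure E} {h : ∀ j, E → D j} (hh : ∀ j, IsFOHom t (s j) (h j)) :
    IsFOHom t (piStr s) fun x j => h j x :=
  ⟨fun f x => funext fun j => (hh j).map_fun f x, fun r x H j => (hh j).map_rel r x H⟩

/-- The structures `s'` over `J` are kept apart from `s` because, for Kripke models, the structure
at an extended family of worlds equals the original one on `J` only propositionally. -/
theorem isFOHom_extend [∀ i, Nonempty (D i)] {s : ∀ i, L.Structure (D i)}
    {t : L.Structure (UProd U D)} (h : IsUltraStr U (UProd.mk U) s t)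
    {J : Set ι} (hJ : J ∈ (U : Filter ι)) {s' : ∀ j : J, L.Structure (D j)}
    (hs : ∀ j : J, s j = s' j) :
    IsFOHom (piStr s') t fun k => UProd.mk U (UProd.extend k) := by
  obtain rfl : (fun j : J => s j) = s' := funext hs
  refine ⟨fun f x => ?_, fun r x H => ?_⟩
  · refine (UProd.mk_extend hJ _ (fun i => (s i).funMap f fun a => UProd.extend (x a) i)
      fun j => congrArg ((s j).funMap f) (funext fun a => ?_)).trans
      (h.funMap f fun i a => UProd.extend (x a) i).symm
    exact (UProd.extend_apply (x a) j).symm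
  · refine (h.relMap r fun i a => UProd.extend (x a) i).2 (Filter.mem_of_superset hJ fun i hi => ?_)
    have := H ⟨i, hi⟩
    rwa [← funext fun a => UProd.extend_apply (x a) ⟨i, hi⟩] at this

/-- Function symbols are total in all factors, so the component at `Set.univ` handles them; a
relation is handled by the component at the set of indices where it holds. -/
theorem isFOHom_desc {s : ∀ i, L.Structure (D i)}
    {t : L.Structure (UProd U D)} (h : IsUltraStr U (UProd.mk U) s t) {E : Type u}
    {t' : L.Structure E}
    (c : ∀ J : {J : Set ι // J ∈ (U : Filter ι)}, (∀ j : J.1, D j) → E)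
    (hc : ∀ J (k : ∀ i, D i), c J (fun j => k j) = c ⟨Set.univ, Filter.univ_mem⟩ (fun j => k j))
    (hh : ∀ J, IsFOHom (piStr fun j : J.1 => s j) t' (c J)) :
    IsFOHom t t' (UProd.desc c hc) := by
  have key : ∀ J {n : ℕ} (x : ∀ i, Fin n → D i),
      UProd.desc c hc ∘ tuple (UProd.mk U) x = c J ∘ fun a j => x j a :=
    fun J _ x => funext fun a => UProd.desc_mk c hc J _
  refine ⟨fun f x => ?_, fun r x H => ?_⟩
  · obtain ⟨x, rfl⟩ := UProd.isUltra_mk.tuple_surjective _ x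
    rw [h.funMap, key ⟨Set.univ, Filter.univ_mem⟩]
    exact (hh _).map_fun f fun a j => x j a
  · obtain ⟨x, rfl⟩ := UProd.isUltra_mk.tuple_surjective _ x
    rw [h.relMap] at H
    rw [key ⟨_, H⟩]
    exact (hh ⟨_, H⟩).map_rel r _ fun j => j.2

end

/-! ## Open first-order logics -/

namespace FModel

variable {L : FOLSig.{u}}

attribute [instance] FModel.ne

/-- `q` exhibits `N` as the ultraproduct of the structures `M i`. -/
structure IsUltra {ι : Type u} (U : Ultrafilter ι) (M : ι → FModel L) (N : FModel L)
    (q : (∀ i, (M i).D) → N.D) : Prop where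
  carrier : Strat.IsUltra U q
  str : IsUltraStr U q (fun i => (M i).str) N.str

theorem IsUltra.const_elim {ι : Type u} {U : Ultrafilter ι} {M : ι → FModel L} {N : FModel L}
    {q : (∀ i, (M i).D) → N.D} (h : IsUltra U M N q) {k : ℕ} (v : ∀ i, Fin k → (M i).D)
    (n : L.Functions 0 ⊕ Fin k) :
    Sum.elim (fun a => N.str.funMap a Fin.elim0) (tuple q v) n
      = q fun i => Sum.elim (fun a => (M i).str.funMap a Fin.elim0) (v i) n := by
  cases n with
  | inl a =>
    exact (congrArg (N.str.funMap a) (tuple_elim0 q fun _ => Fin.elim0).symm).trans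
      (h.str.funMap a fun _ => Fin.elim0)
  | inr c => rfl

/-- Membership in the power relation is a conjunction over `X`; finiteness of the block of variables
lets it commute with `∀ᶠ`. -/
theorem IsUltra.mem_powRel {ι : Type u} {U : Ultrafilter ι} {M : ι → FModel L} {N : FModel L}
    {q : (∀ i, (M i).D) → N.D} (h : IsUltra U M N q) {X : Type u} [Finite X] {n : ℕ}
    (r : L.Relations n) (y : ∀ i, Fin n → X → (M i).D) :
    (fun a => tuple q fun i => y i a) ∈ N.powRel X r ↔ ∀ᶠ i in U, y i ∈ (M i).powRel X r := by
  simp only [powRel, Set.mem_ofPred_eq, Filter.eventually_all]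
  exact forall_congr' fun x => h.str.relMap r fun i a => y i a x

end FModel

/-- The Łoś theorem. -/
theorem OForm.sat_iff_eventually {hyb modal : Bool} {L : FOLSig.{u}} {X : Type u} [Finite X]
    {ι : Type u} {U : Ultrafilter ι} {M : ι → FModel L} {N : FModel L}
    {q : (∀ i, (M i).D) → N.D} (h : FModel.IsUltra U M N q) {k : ℕ}
    (ρ : OForm hyb modal L X k) (v : ∀ i, Fin k → (M i).D) (w : ∀ i, X → (M i).D) :
    Sat N ρ (tuple q v) (tuple q w) ↔ ∀ᶠ i in U, Sat (M i) ρ (v i) (w i) := by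
  induction ρ generalizing w with
  | atom r t =>
    simp only [Sat, tuple_sumElim]
    exact h.str.relMap_realize r t _
  | and ρ σ h1 h2 => simp only [Sat, Filter.eventually_and, h1, h2]
  | neg ρ h1 => simp only [Sat, Ultrafilter.eventually_not, h1]
  | ex ρ h1 =>
    refine h.carrier.exists_iff fun a => ?_
    rw [tuple_snoc, h1]
  | @poss k n hm r ρ h1 =>
    -- The witnesses are tuples of valuations, that is, families with two indices, so the
    -- existential step is applied to the projection acting on both.
    refine IsUltra.exists_iff_of_surjective
      (r := fun (u : ∀ i, Fin n → X → (M i).D) a => tuple q fun i => u i a) ?_ fun u => ?_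
    · intro y
      choose u hu using fun a => h.carrier.tuple_surjective X (y a)
      exact ⟨fun i a => u a i, funext hu⟩
    · rw [Filter.eventually_and, Filter.eventually_all, ← h.mem_powRel]
      refine and_congr (iff_of_eq (congrArg (· ∈ _) ?_)) (forall_congr' fun a => h1 a v _)
      funext a
      cases a using Fin.cases <;> rfl
  | nom hh n =>
    simp only [Sat, h.const_elim]
    -- The state is compared with a constant valuation; equality of valuations is an
    -- almost-everywhere condition because `X` is finite.
    exact h.carrier.tuple_eq_iff (fun i _ => _) w
  | sat hh n ρ h1 =>
    simp only [Sat, h.const_elim]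
    exact h1 v fun i _ => _

theorem OForm.sentence_sat_iff_eventually {hyb modal : Bool} {L : FOLSig.{u}} {X : Type u}
    [Finite X] {ι : Type u} {U : Ultrafilter ι} {M : ι → FModel L} {N : FModel L}
    {q : (∀ i, (M i).D) → N.D} (h : FModel.IsUltra U M N q)
    (ρ : OForm hyb modal L X 0) (w : ∀ i, X → (M i).D) :
    Sat N ρ Fin.elim0 (tuple q w) ↔ ∀ᶠ i in U, Sat (M i) ρ Fin.elim0 (w i) := by
  rw [← sat_iff_eventually h, tuple_elim0]

namespace FModel

variable {L : FOLSig.{u}}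

theorem isUltra_of_iso {M N : FModel L} (e : M ≅ N) :
    IsUltra (pure PUnit.unit : Ultrafilter PUnit.{u + 1}) (fun _ => M) N
      fun k => e.hom.toFun (k ⟨⟩) where
  carrier := isUltra_pure <| Function.bijective_iff_has_inverse.2
    ⟨e.inv.toFun, congrFun (congrArg Hom.toFun e.hom_inv_id),
      congrFun (congrArg Hom.toFun e.inv_hom_id)⟩
  str := isUltraStr_of_inverse e.hom.isHom e.inv.isHom
    (congrFun (congrArg Hom.toFun e.hom_inv_id))

variable {ι : Type u} {U : Ultrafilter ι}

/-- The system of direct products of a family of structures. -/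
def productSystem (F : Filter ι) (M : ι → FModel L) : ProductSystem F M where
  prod J := { D := ∀ j : J.1, (M j).D, str := piStr fun j : J.1 => (M j).str }
  proj _ i := ⟨fun k => k i, isFOHom_eval _ i⟩
  isProd _ := Limits.Fan.IsLimit.mk _
    (fun s => ⟨fun x j => (s.proj j).toFun x, isFOHom_pi fun j => (s.proj j).isHom⟩)
    (fun _ _ => rfl)
    (fun _ _ hm => Hom.ext <| funext fun x => funext fun j =>
      congrFun (congrArg (fun f => f.toFun) (hm j)) x)

/-- The ultraproduct. -/
noncomputable def ultra (U : Ultrafilter ι) (M : ι → FModel L) : FModel L where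
  D := UProd U fun i => (M i).D
  ne := ⟨UProd.mk U fun _ => Classical.arbitrary _⟩
  str := ultraStr U fun i => (M i).str

theorem isUltra_ultra (U : Ultrafilter ι) (M : ι → FModel L) :
    IsUltra U M (ultra U M) (UProd.mk U) :=
  ⟨UProd.isUltra_mk, isUltraStr_ultraStr _⟩

theorem compatible_toFun {M : ι → FModel L} {N : FModel L}
    {c : ∀ J, (productSystem (U : Filter ι) M).prod J ⟶ N}
    (hc : (productSystem (U : Filter ι) M).Compatible c) (J) (k : ∀ i, (M i).D) :
    (c J).toFun (fun j => k j) = (c ⟨Set.univ, Filter.univ_mem⟩).toFun fun j => k j := by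
  obtain ⟨r, hr, hrc⟩ := hc.exists_restrict J
  rw [← hrc]
  refine congrArg (c J).toFun (funext fun j => ?_)
  exact (congrArg (fun f => f.toFun fun j : Set.univ => k j) (hr j)).symm

noncomputable def filteredProduct (U : Ultrafilter ι) (M : ι → FModel L) :
    FilteredProduct (U : Filter ι) M :=
  (productSystem (U : Filter ι) M).filteredProduct (ultra U M)
    (fun J => ⟨fun k => UProd.mk U (UProd.extend k),
      isFOHom_extend (D := fun i => (M i).D) (isUltra_ultra U M).str J.2 fun _ => rfl⟩)
    (fun J J' h r hr => Hom.ext <| funext fun k =>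
      UProd.mk_extend (X := fun i => (M i).D) J'.2 _ _ fun j =>
      (congrFun (congrArg (fun f => f.toFun) (hr j)) k).trans
        (UProd.extend_apply (X := fun i => (M i).D) k ⟨j, h j.2⟩).symm)
    (fun c hc => ⟨UProd.desc (X := fun i => (M i).D) (fun J => (c J).toFun) (compatible_toFun hc),
      isFOHom_desc (D := fun i => (M i).D) (isUltra_ultra U M).str _ _ fun J => (c J).isHom⟩)
    (fun c hc J => Hom.ext <| funext fun k =>
      UProd.desc_mk_extend (X := fun i => (M i).D) (fun J => (c J).toFun)
        (compatible_toFun hc) J k)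
    (fun d d' h => by
      refine Hom.ext (funext fun w => ?_)
      obtain ⟨k, rfl⟩ := (isUltra_ultra U M).carrier.surj w
      rw [← UProd.mk_extend_univ k]
      exact congrArg (fun f => f.toFun fun j : Set.univ => k j) (h ⟨Set.univ, Filter.univ_mem⟩))

end FModel

theorem OSig.onVar_injective {V : Type u} {hyb modal : Bool} {S T : OSig V hyb modal} (φ : S ⟶ T) :
    Function.Injective (onVar φ) :=
  fun _ _ h => Subtype.ext (congrArg (fun y : T.X => y.1) h)

theorem openFO_isLos (V : Type u) (hyb modal : Bool) : (openFO V hyb modal).IsLos where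
  iso e w ρ :=
    ((OForm.sentence_sat_iff_eventually (FModel.isUltra_of_iso e) ρ fun _ => w).trans
      Filter.eventually_pure).symm
  nonempty M := ⟨fun _ => M.ne.some⟩
  neg ρ := ⟨OForm.neg ρ, fun _ _ => Iff.rfl⟩
  -- A valuation of the smaller block extends to the larger one because the carrier is non-empty.
  surj φ M w := by
    have : Nonempty (FModel.D M) := FModel.ne M
    exact (OSig.onVar_injective φ).surjective_comp_right (γ := FModel.D M) w
  ultra {S _} U M :=
    ⟨FModel.filteredProduct U M, tuple (UProd.mk U) (X := fun i => (M i).D) (κ := S.X),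
      (FModel.isUltra_ultra U M).carrier.tuple_surjective _,
      fun J k' k h => funext fun x => have := fun i => FModel.ne (M i)
        UProd.mk_extend (X := fun i => (M i).D) J.2
        (fun j => (k' x : ∀ j : J.1, (M j).D) j) (fun i => (k i : S.X → (M i).D) x)
        fun j => congrFun (h j) x,
      fun _ k => ⟨fun x j => (k j : S.X → (M j).D) x, fun _ => rfl⟩,
      fun k ρ => OForm.sentence_sat_iff_eventually (FModel.isUltra_ultra U M) ρ k⟩

/-! ## First-order Kripke logics -/

namespace QModel

variable {S : QSig.{u}}

attribute [instance] QModel.ne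

/-- `q` and `q'` exhibit `N` as the ultraproduct of the Kripke structures `M i`. -/
structure IsUltra {ι : Type u} (U : Ultrafilter ι) (M : ι → QModel S) (N : QModel S)
    (q : (∀ i, (M i).frame.W) → N.frame.W) (q' : (∀ i, (M i).D) → N.D) : Prop where
  frame : Frame.IsUltra U (fun i => (M i).frame) N.frame q
  carrier : Strat.IsUltra U q'
  str : ∀ k : ∀ i, (M i).frame.W, IsUltraStr U q' (fun i => (M i).str (k i)) (N.str (q k))

end QModel

/-- The Łoś theorem. -/
theorem QForm.sat_iff_eventually {hyb : Bool} {S : QSig.{u}} {ι : Type u} {U : Ultrafilter ι}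
    {M : ι → QModel S} {N : QModel S} {q : (∀ i, (M i).frame.W) → N.frame.W}
    {q' : (∀ i, (M i).D) → N.D} (h : QModel.IsUltra U M N q q') {k m : ℕ}
    (ρ : QForm hyb S.1 S.2 k m) (v : ∀ i, Fin k → (M i).frame.W) (x : ∀ i, Fin m → (M i).D)
    (w : ∀ i, (M i).frame.W) :
    Sat N ρ (tuple q v) (tuple q' x) (q w) ↔ ∀ᶠ i in U, Sat (M i) ρ (v i) (x i) (w i) := by
  induction ρ generalizing w with
  | atom r t => exact (h.str w).relMap_realize r t x
  | and ρ σ h1 h2 => simp only [Sat, Filter.eventually_and, h1, h2]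
  | neg ρ h1 => simp only [Sat, Ultrafilter.eventually_not, h1]
  | ex ρ h1 =>
    refine h.carrier.exists_iff fun a => ?_
    rw [tuple_snoc, h1]
  | poss l ρ h1 =>
    refine h.frame.exists_tuple_iff fun u => ?_
    rw [tuple_cons, h.frame.rel, Filter.eventually_and, Filter.eventually_all]
    exact and_congr Iff.rfl (forall_congr' fun a => h1 a v x fun i => u i a)
  | nom hh n => simp only [Sat, h.frame.nom_elim, h.frame.eq_iff]
  | sat hh n ρ h1 => simp only [Sat, h.frame.nom_elim, h1]
  | exNom hh ρ h1 =>
    refine h.frame.exists_iff fun a => ?_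
    rw [tuple_snoc, h1]

theorem QForm.sentence_sat_iff_eventually {hyb : Bool} {S : QSig.{u}} {ι : Type u}
    {U : Ultrafilter ι} {M : ι → QModel S} {N : QModel S} {q : (∀ i, (M i).frame.W) → N.frame.W}
    {q' : (∀ i, (M i).D) → N.D} (h : QModel.IsUltra U M N q q') (ρ : QForm hyb S.1 S.2 0 0)
    (w : ∀ i, (M i).frame.W) :
    Sat N ρ Fin.elim0 Fin.elim0 (q w) ↔ ∀ᶠ i in U, Sat (M i) ρ Fin.elim0 Fin.elim0 (w i) := by
  rw [← sat_iff_eventually h, tuple_elim0, tuple_elim0]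

namespace QModel

variable {S : QSig.{u}}

/-- The isomorphism of frames underlying an isomorphism of models. -/
def frameIso {M N : QModel S} (e : M ≅ N) : M.frame ≅ N.frame where
  hom := e.hom.frame
  inv := e.inv.frame
  hom_inv_id := congrArg Hom.frame e.hom_inv_id
  inv_hom_id := congrArg Hom.frame e.inv_hom_id

theorem isUltra_of_iso {M N : QModel S} (e : M ≅ N) :
    IsUltra (pure PUnit.unit : Ultrafilter PUnit.{u + 1}) (fun _ => M) N
      (fun k => e.hom.frame.toFun (k ⟨⟩)) fun k => e.hom.toFun (k ⟨⟩) where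
  frame := Frame.isUltra_of_iso (frameIso e)
  carrier := isUltra_pure <| Function.bijective_iff_has_inverse.2
    ⟨e.inv.toFun, congrFun (congrArg Hom.toFun e.hom_inv_id),
      congrFun (congrArg Hom.toFun e.inv_hom_id)⟩
  str k := isUltraStr_of_inverse (h' := e.inv.toFun) (e.hom.isHom (k ⟨⟩))
    (by
      -- The inverse is a homomorphism into the structure at the world obtained by going forth and
      -- back, which must first be identified with the original world.
      have := e.inv.isHom (e.hom.frame.toFun (k ⟨⟩))
      rwa [show e.inv.frame.toFun (e.hom.frame.toFun (k ⟨⟩)) = k ⟨⟩ from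
        congrFun (congrArg Frame.Hom.toFun (frameIso e).hom_inv_id) _] at this)
    (congrFun (congrArg Hom.toFun e.hom_inv_id))

variable {ι : Type u} {U : Ultrafilter ι}

/-- The system of direct products of a family of Kripke structures. -/
def productSystem (F : Filter ι) (M : ι → QModel S) : ProductSystem F M where
  prod J :=
    { frame := Frame.pi fun j : J.1 => (M j).frame
      D := ∀ j : J.1, (M j).D
      str := fun w => piStr fun j : J.1 => (M j).str (w j)
      rigid := fun w w' c _ => funext fun j => (M j).rigid (w j) (w' j) c _ }
  proj J i := ⟨Frame.proj (fun j : J.1 => (M j).frame) i, fun k => k i, fun _ => isFOHom_eval _ i⟩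
  isProd _ := Limits.Fan.IsLimit.mk _
    (fun s => ⟨Frame.lift fun j => (s.proj j).frame, fun x j => (s.proj j).toFun x,
      fun w => isFOHom_pi fun j => (s.proj j).isHom w⟩)
    (fun _ _ => rfl)
    (fun _ _ hm => Hom.ext
      (Frame.Hom.ext <| funext fun x => funext fun j =>
        congrFun (congrArg (fun f => f.frame.toFun) (hm j)) x)
      (funext fun x => funext fun j => congrFun (congrArg (fun f => f.toFun) (hm j)) x))

/-- The ultraproduct. -/
noncomputable def ultra (U : Ultrafilter ι) (M : ι → QModel S) : QModel S where
  frame := Frame.ultra U fun i => (M i).frame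
  D := UProd U fun i => (M i).D
  ne := ⟨UProd.mk U fun _ => Classical.arbitrary _⟩
  str w := ultraStr U fun i => (M i).str (UProd.rep w i)
  -- Rigidity holds factor by factor, whatever representatives of the two worlds are chosen.
  rigid _ _ c _ := congrArg (UProd.mk U) (funext fun i => (M i).rigid _ _ c _)

theorem isUltra_ultra (U : Ultrafilter ι) (M : ι → QModel S) :
    IsUltra U M (ultra U M) (UProd.mk U) (UProd.mk U) where
  frame := Frame.isUltra_ultra U _
  carrier := UProd.isUltra_mk
  str k := (isUltraStr_ultraStr _).congr UProd.isUltra_mk <|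
    (UProd.rep_mk k).mono fun i h => congrArg (M i).str h

variable {M : ι → QModel S}

theorem compatible_frame {N : QModel S}
    {c : ∀ J, (productSystem (U : Filter ι) M).prod J ⟶ N}
    (hc : (productSystem (U : Filter ι) M).Compatible c) (J) (k : ∀ i, (M i).frame.W) :
    (c J).frame.toFun (fun j => k j)
      = (c ⟨Set.univ, Filter.univ_mem⟩).frame.toFun fun j => k j := by
  obtain ⟨r, hr, hrc⟩ := hc.exists_restrict J
  rw [← hrc]
  refine congrArg (c J).frame.toFun (funext fun j => ?_)
  exact (congrArg (fun f => f.frame.toFun fun j : Set.univ => k j) (hr j)).symm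

theorem compatible_toFun {N : QModel S}
    {c : ∀ J, (productSystem (U : Filter ι) M).prod J ⟶ N}
    (hc : (productSystem (U : Filter ι) M).Compatible c) (J) (k : ∀ i, (M i).D) :
    (c J).toFun (fun j => k j) = (c ⟨Set.univ, Filter.univ_mem⟩).toFun fun j => k j := by
  obtain ⟨r, hr, hrc⟩ := hc.exists_restrict J
  rw [← hrc]
  refine congrArg (c J).toFun (funext fun j => ?_)
  exact (congrArg (fun f => f.toFun fun j : Set.univ => k j) (hr j)).symm

/-- The canonical homomorphism from the product over a member of `U`. -/
noncomputable def incl (M : ι → QModel S) (J : {J : Set ι // J ∈ (U : Filter ι)}) :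
    (productSystem (U : Filter ι) M).prod J ⟶ ultra U M where
  frame := Frame.incl (fun i => (M i).frame) J
  toFun k := UProd.mk U (UProd.extend k)
  isHom w := isFOHom_extend (D := fun i => (M i).D) ((isUltra_ultra U M).str (UProd.extend w)) J.2
    fun j => congrArg (M j).str (UProd.extend_apply (X := fun i => (M i).frame.W) w j)

/-- The homomorphism induced on the ultraproduct by a compatible family. -/
def desc {N : QModel S} (c : ∀ J, (productSystem (U : Filter ι) M).prod J ⟶ N)
    (hc : (productSystem (U : Filter ι) M).Compatible c) : ultra U M ⟶ N where
  frame := Frame.desc (fun J => (c J).frame) (compatible_frame hc)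
  toFun := UProd.desc (X := fun i => (M i).D) (fun J => (c J).toFun) (compatible_toFun hc)
  isHom w := by
    obtain ⟨k, rfl⟩ := (isUltra_ultra U M).frame.surj w
    -- With `w` represented by `k`, every component of the cocone sends the restriction of `k` to
    -- the same world of `N`, so all of them are homomorphisms into one and the same structure.
    refine isFOHom_desc (D := fun i => (M i).D) ((isUltra_ultra U M).str k) _ _ fun J => ?_
    have := (c J).isHom fun j => k j
    exact (congrArg (fun y => IsFOHom _ (N.str y) (c J).toFun)
      (UProd.desc_mk (X := fun i => (M i).frame.W) (fun J => (c J).frame.toFun)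
        (compatible_frame hc) J k)).mpr this

noncomputable def filteredProduct (U : Ultrafilter ι) (M : ι → QModel S) :
    FilteredProduct (U : Filter ι) M :=
  (productSystem (U : Filter ι) M).filteredProduct (ultra U M) (incl M)
    (fun J J' h r hr => Hom.ext
      (Frame.Hom.ext <| funext fun k =>
        UProd.mk_extend (X := fun i => (M i).frame.W) J'.2 _ _ fun j =>
        (congrFun (congrArg (fun f => f.frame.toFun) (hr j)) k).trans
          (UProd.extend_apply (X := fun i => (M i).frame.W) k ⟨j, h j.2⟩).symm)
      (funext fun k => UProd.mk_extend (X := fun i => (M i).D) J'.2 _ _ fun j =>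
        (congrFun (congrArg (fun f => f.toFun) (hr j)) k).trans
          (UProd.extend_apply (X := fun i => (M i).D) k ⟨j, h j.2⟩).symm))
    desc
    (fun c hc J => Hom.ext
      (Frame.Hom.ext <| funext fun k =>
        UProd.desc_mk_extend (X := fun i => (M i).frame.W) (fun J => (c J).frame.toFun)
          (compatible_frame hc) J k)
      (funext fun k => UProd.desc_mk_extend (X := fun i => (M i).D) (fun J => (c J).toFun)
        (compatible_toFun hc) J k))
    (fun d d' h => by
      refine Hom.ext (Frame.Hom.ext (funext fun w => ?_)) (funext fun w => ?_)
      · obtain ⟨k, rfl⟩ := (isUltra_ultra U M).frame.surj w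
        rw [← UProd.mk_extend_univ k]
        exact congrArg (fun f => f.frame.toFun fun j : Set.univ => k j)
          (h ⟨Set.univ, Filter.univ_mem⟩)
      · obtain ⟨k, rfl⟩ := (isUltra_ultra U M).carrier.surj w
        rw [← UProd.mk_extend_univ k]
        exact congrArg (fun f => f.toFun fun j : Set.univ => k j)
          (h ⟨Set.univ, Filter.univ_mem⟩))

end QModel

theorem kripkeFO_isLos (hyb : Bool) : (kripkeFO.{u} hyb).IsLos where
  iso e w ρ :=
    ((QForm.sentence_sat_iff_eventually (QModel.isUltra_of_iso e) ρ fun _ => w).trans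
      Filter.eventually_pure).symm
  nonempty M := M.frame.ne
  neg ρ := ⟨QForm.neg ρ, fun _ _ => Iff.rfl⟩
  surj _ _ w := ⟨w, rfl⟩
  ultra U M :=
    ⟨QModel.filteredProduct U M, UProd.mk U, (QModel.isUltra_ultra U M).frame.surj,
      fun J k' k h => UProd.mk_extend (X := fun i => (M i).frame.W) J.2 k' k h,
      fun _ k => ⟨fun j => k j, fun _ => rfl⟩,
      fun k ρ => QForm.sentence_sat_iff_eventually (QModel.isUltra_ultra U M) ρ k⟩

/-! ## Double hybridization of propositional logic -/

namespace HHModel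

variable {S : HHSig.{u}}

attribute [instance] HHModel.ne

/-- `q` and `q'` exhibit `N` as the ultraproduct of the structures `M i`. -/
structure IsUltra {ι : Type u} (U : Ultrafilter ι) (M : ι → HHModel S) (N : HHModel S)
    (q : (∀ i, (M i).frame.W) → N.frame.W) (q' : (∀ i, (M i).W₀) → N.W₀) : Prop where
  frame : Frame.IsUltra U (fun i => (M i).frame) N.frame q
  loc : ∀ k : ∀ i, (M i).frame.W,
    PModel.IsUltra U (fun i => (M i).loc (k i)) (N.loc (q k)) q'

/-- The lower worlds are shared by all upper worlds, so any family of upper worlds, which exists by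
non-emptiness, gives access to them. -/
theorem IsUltra.lower {ι : Type u} {U : Ultrafilter ι} {M : ι → HHModel S} {N : HHModel S}
    {q : (∀ i, (M i).frame.W) → N.frame.W} {q' : (∀ i, (M i).W₀) → N.W₀}
    (h : IsUltra U M N q q') : Strat.IsUltra U q' :=
  (h.loc fun _ => Classical.arbitrary _).frame.toIsUltra

end HHModel

theorem tuple_pair {ι : Type u} {X : ι → Type u} {Y : Type u} (q : (∀ i, X i) → Y)
    (a b : ∀ i, X i) : ![q a, q b] = tuple q fun i => ![a i, b i] := by
  funext c
  fin_cases c <;> rfl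

/-- The Łoś theorem. -/
theorem HHForm.sat_iff_eventually {S : HHSig.{u}} {ι : Type u} {U : Ultrafilter ι}
    {M : ι → HHModel S} {N : HHModel S} {q : (∀ i, (M i).frame.W) → N.frame.W}
    {q' : (∀ i, (M i).W₀) → N.W₀} (h : HHModel.IsUltra U M N q q') {j k : ℕ}
    (ρ : HHForm S j k) (x : ∀ i, Fin j → (M i).W₀) (v : ∀ i, Fin k → (M i).frame.W)
    (w : ∀ i, (M i).frame.W) :
    Sat N ρ (tuple q' x) (tuple q v) (q w) ↔ ∀ᶠ i in U, Sat (M i) ρ (x i) (v i) (w i) := by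
  induction ρ generalizing w with
  -- An atom is a universal statement over the lower worlds, so the lower Łoś theorem, applied to
  -- the local models along `w`, is followed by the universal quantifier step.
  | base ρ => exact h.lower.forall_iff fun a => PForm.sat_iff_eventually (h.loc w) ρ x a
  | and ρ σ h1 h2 => simp only [Sat, Filter.eventually_and, h1, h2]
  | neg ρ h1 => simp only [Sat, Ultrafilter.eventually_not, h1]
  | dia ρ h1 =>
    refine h.frame.exists_iff fun u => ?_
    rw [Filter.eventually_and, h1, tuple_pair]
    exact and_congr (h.frame.rel Dia.dia _) Iff.rfl
  | nom n => exact (iff_of_eq (congrArg (· = _) (h.frame.nom_elim v n))).trans (h.frame.eq_iff _ _)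
  | sat n ρ h1 =>
    exact (iff_of_eq (congrArg (Sat N ρ _ _) (h.frame.nom_elim v n))).trans (h1 x v _)
  | exNom₁ ρ h1 =>
    refine h.frame.exists_iff fun a => ?_
    rw [tuple_snoc, h1]
  | exNom₀ ρ h1 =>
    refine h.lower.exists_iff fun a => ?_
    rw [tuple_snoc, h1]

theorem HHForm.sentence_sat_iff_eventually {S : HHSig.{u}} {ι : Type u} {U : Ultrafilter ι}
    {M : ι → HHModel S} {N : HHModel S} {q : (∀ i, (M i).frame.W) → N.frame.W}
    {q' : (∀ i, (M i).W₀) → N.W₀} (h : HHModel.IsUltra U M N q q') (ρ : HHForm S 0 0)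
    (w : ∀ i, (M i).frame.W) :
    Sat N ρ Fin.elim0 Fin.elim0 (q w) ↔ ∀ᶠ i in U, Sat (M i) ρ Fin.elim0 Fin.elim0 (w i) := by
  rw [← sat_iff_eventually h, tuple_elim0, tuple_elim0]

namespace HHModel

variable {S : HHSig.{u}}

/-- The isomorphism of frames underlying an isomorphism of models. -/
def frameIso {M N : HHModel S} (e : M ≅ N) : M.frame ≅ N.frame where
  hom := e.hom.frame
  inv := e.inv.frame
  hom_inv_id := congrArg Hom.frame e.hom_inv_id
  inv_hom_id := congrArg Hom.frame e.inv_hom_id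

/-- The homomorphism of local models underlying a homomorphism. -/
def locHom {M N : HHModel S} (f : M ⟶ N) (w : M.frame.W) : M.loc w ⟶ N.loc (f.frame.toFun w) where
  frame :=
    -- The existential in `Hom.isHom` cannot be eliminated into data; the map is taken from `f`, and
    -- the existential is opened only for the propositional fields.
    { toFun := f.toFun
      map_nom := fun n => by
        obtain ⟨g, hg⟩ := f.isHom w
        rw [← hg]
        exact g.frame.map_nom n
      map_rel := fun l v hv => by
        obtain ⟨g, hg⟩ := f.isHom w
        rw [← hg]
        exact g.frame.map_rel l v hv }
  map_val a := by
    obtain ⟨g, hg⟩ := f.isHom w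
    dsimp only
    rw [← hg]
    exact g.map_val a

theorem isUltra_of_iso {M N : HHModel S} (e : M ≅ N) :
    IsUltra (pure PUnit.unit : Ultrafilter PUnit.{u + 1}) (fun _ => M) N
      (fun k => e.hom.frame.toFun (k ⟨⟩)) fun k => e.hom.toFun (k ⟨⟩) where
  frame := Frame.isUltra_of_iso (frameIso e)
  loc k := by
    obtain ⟨g, hg⟩ : ∃ g : N.loc (e.hom.frame.toFun (k ⟨⟩)) ⟶ M.loc (k ⟨⟩),
        g.frame.toFun = e.inv.toFun := by
      -- The local inverse lands at the image of the image of `k ⟨⟩`, which is rewritten to `k ⟨⟩`;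
      -- this is why `PModel.isUltra_of_inverse` asks for two homomorphisms rather than an
      -- isomorphism.
      have := e.inv.isHom (e.hom.frame.toFun (k ⟨⟩))
      rwa [show e.inv.frame.toFun (e.hom.frame.toFun (k ⟨⟩)) = k ⟨⟩ from
        congrFun (congrArg Frame.Hom.toFun (frameIso e).hom_inv_id) _] at this
    refine PModel.isUltra_of_inverse (locHom e.hom (k ⟨⟩)) g ?_ ?_
    · rw [hg]
      exact congrFun (congrArg Hom.toFun e.hom_inv_id)
    · rw [hg]
      exact congrFun (congrArg Hom.toFun e.inv_hom_id)

variable {ι : Type u} {U : Ultrafilter ι}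

/-- The system of direct products of a family of models. -/
def productSystem (F : Filter ι) (M : ι → HHModel S) : ProductSystem F M where
  prod J :=
    { frame := Frame.pi fun j : J.1 => (M j).frame
      W₀ := ∀ j : J.1, (M j).W₀
      nom₀ := fun n j => (M j).nom₀ n
      rel₀ := fun w _ l => {v | ∀ j : J.1, (fun a => v a j) ∈ (M j).rel₀ (w j) l}
      val := fun w x => {p | ∀ j : J.1, p ∈ (M j).val (w j) (x j)} }
  proj J i := ⟨Frame.proj (fun j : J.1 => (M j).frame) i, fun k => k i,
    fun _ => ⟨⟨⟨fun k => k i, fun _ => rfl, fun _ _ h => h i⟩, fun _ _ hp => hp i⟩, rfl⟩⟩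
  isProd _ := Limits.Fan.IsLimit.mk _
    (fun s => ⟨Frame.lift fun j => (s.proj j).frame, fun x j => (s.proj j).toFun x,
      fun w => ⟨⟨⟨fun x j => (s.proj j).toFun x,
        fun n => funext fun j => (locHom (s.proj j) w).frame.map_nom n,
        fun l v hv j => (locHom (s.proj j) w).frame.map_rel l v hv⟩,
        fun x _ hp j => (locHom (s.proj j) w).map_val x hp⟩, rfl⟩⟩)
    (fun _ _ => rfl)
    (fun _ _ hm => Hom.ext
      (Frame.Hom.ext <| funext fun x => funext fun j =>
        congrFun (congrArg (fun f => f.frame.toFun) (hm j)) x)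
      (funext fun x => funext fun j => congrFun (congrArg (fun f => f.toFun) (hm j)) x))

/-- The ultraproduct. -/
noncomputable def ultra (U : Ultrafilter ι) (M : ι → HHModel S) : HHModel S where
  frame := Frame.ultra U fun i => (M i).frame
  W₀ := UProd U fun i => (M i).W₀
  ne := ⟨UProd.mk U fun _ => Classical.arbitrary _⟩
  nom₀ n := UProd.mk U fun i => (M i).nom₀ n
  rel₀ w _ l := {v | ∀ᶠ i in U, (fun a => (v a).rep i) ∈ (M i).rel₀ (UProd.rep w i) l}
  val w x := {p | ∀ᶠ i in U, p ∈ (M i).val (UProd.rep w i) (x.rep i)}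

theorem isUltra_ultra (U : Ultrafilter ι) (M : ι → HHModel S) :
    IsUltra U M (ultra U M) (UProd.mk U) (UProd.mk U) where
  frame := Frame.isUltra_ultra U _
  loc k :=
    { frame :=
        { toIsUltra := UProd.isUltra_mk
          nom := fun _ => rfl
          rel := fun l v =>
            -- Two representatives were chosen in the definition, for the upper world and for the
            -- lower tuple; they are replaced one after the other.
            (UProd.eventually_rep_mk k fun i w =>
              (fun a => (tuple (UProd.mk U) v a).rep i) ∈ (M i).rel₀ w l).trans
            (UProd.eventually_rep_tuple v fun i x => x ∈ (M i).rel₀ (k i) l) }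
      val := fun x p =>
        (UProd.eventually_rep_mk k fun i w => p ∈ (M i).val w ((UProd.mk U x).rep i)).trans
        (UProd.eventually_rep_mk x fun i x => p ∈ (M i).val (k i) x) }

variable {M : ι → HHModel S}

theorem compatible_frame {N : HHModel S}
    {c : ∀ J, (productSystem (U : Filter ι) M).prod J ⟶ N}
    (hc : (productSystem (U : Filter ι) M).Compatible c) (J) (k : ∀ i, (M i).frame.W) :
    (c J).frame.toFun (fun j => k j)
      = (c ⟨Set.univ, Filter.univ_mem⟩).frame.toFun fun j => k j := by
  obtain ⟨r, hr, hrc⟩ := hc.exists_restrict J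
  rw [← hrc]
  refine congrArg (c J).frame.toFun (funext fun j => ?_)
  exact (congrArg (fun f => f.frame.toFun fun j : Set.univ => k j) (hr j)).symm

theorem compatible_toFun {N : HHModel S}
    {c : ∀ J, (productSystem (U : Filter ι) M).prod J ⟶ N}
    (hc : (productSystem (U : Filter ι) M).Compatible c) (J) (k : ∀ i, (M i).W₀) :
    (c J).toFun (fun j => k j) = (c ⟨Set.univ, Filter.univ_mem⟩).toFun fun j => k j := by
  obtain ⟨r, hr, hrc⟩ := hc.exists_restrict J
  rw [← hrc]
  refine congrArg (c J).toFun (funext fun j => ?_)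
  exact (congrArg (fun f => f.toFun fun j : Set.univ => k j) (hr j)).symm

/-- The canonical homomorphism from the product over a member of `U`. -/
noncomputable def incl (M : ι → HHModel S) (J : {J : Set ι // J ∈ (U : Filter ι)}) :
    (productSystem (U : Filter ι) M).prod J ⟶ ultra U M where
  frame := Frame.incl (fun i => (M i).frame) J
  toFun k := UProd.mk U (UProd.extend k)
  isHom w := by
    have h := (isUltra_ultra U M).loc (UProd.extend (X := fun i => (M i).frame.W) w)
    refine ⟨⟨⟨fun k => UProd.mk U (UProd.extend (X := fun i => (M i).W₀) k), fun n => ?_,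
      fun l v hv => ?_⟩, fun x p hp => ?_⟩, rfl⟩
    · exact UProd.mk_extend (X := fun i => (M i).W₀) J.2 _ (fun i => (M i).nom₀ n) fun _ => rfl
    · refine (h.frame.rel l fun i a => UProd.extend (X := fun i => (M i).W₀) (v a) i).2
        (Filter.mem_of_superset J.2 fun i hi => ?_)
      have := hv ⟨i, hi⟩
      rwa [← UProd.extend_apply (X := fun i => (M i).frame.W) w ⟨i, hi⟩,
        ← funext fun a => UProd.extend_apply (X := fun i => (M i).W₀) (v a) ⟨i, hi⟩] at this
    · refine (h.val (UProd.extend (X := fun i => (M i).W₀) x) p).2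
        (Filter.mem_of_superset J.2 fun i hi => ?_)
      have := hp ⟨i, hi⟩
      rwa [← UProd.extend_apply (X := fun i => (M i).frame.W) w ⟨i, hi⟩,
        ← UProd.extend_apply (X := fun i => (M i).W₀) x ⟨i, hi⟩] at this

/-- The homomorphism induced on the ultraproduct by a compatible family. -/
def desc {N : HHModel S} (c : ∀ J, (productSystem (U : Filter ι) M).prod J ⟶ N)
    (hc : (productSystem (U : Filter ι) M).Compatible c) : ultra U M ⟶ N where
  frame := Frame.desc (fun J => (c J).frame) (compatible_frame hc)
  toFun := UProd.desc (X := fun i => (M i).W₀) (fun J => (c J).toFun) (compatible_toFun hc)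
  isHom w := by
    obtain ⟨k, rfl⟩ := (isUltra_ultra U M).frame.surj w
    have h := (isUltra_ultra U M).loc k
    have hk : ∀ J, (Frame.desc (fun J => (c J).frame) (compatible_frame hc)).toFun (UProd.mk U k)
        = (c J).frame.toFun fun j => k j := fun J =>
      UProd.desc_mk (X := fun i => (M i).frame.W) (fun J => (c J).frame.toFun)
        (compatible_frame hc) J k
    have hx : ∀ J x, UProd.desc (X := fun i => (M i).W₀) (fun J => (c J).toFun)
        (compatible_toFun hc) (UProd.mk U x) = (c J).toFun fun j => x j := fun J x =>
      UProd.desc_mk (X := fun i => (M i).W₀) (fun J => (c J).toFun) (compatible_toFun hc) J x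
    refine ⟨⟨⟨UProd.desc (X := fun i => (M i).W₀) (fun J => (c J).toFun) (compatible_toFun hc),
      (locHom (c ⟨Set.univ, Filter.univ_mem⟩) fun j => k j).frame.map_nom, fun l v hv => ?_⟩, ?_⟩,
      rfl⟩
    · obtain ⟨v, rfl⟩ := h.frame.tuple_surjective _ v
      rw [h.frame.rel] at hv
      -- Again the component at the set where the relation holds is used, now in the local models
      -- along the restriction of `k`.
      have := (locHom (c ⟨_, hv⟩) fun j => k j).frame.map_rel l (fun a j => v j a) fun j => j.2
      rw [hk ⟨_, hv⟩]
      refine (congrArg (· ∈ N.rel₀ _ l) (funext fun a => ?_)).mpr this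
      exact hx ⟨_, hv⟩ fun i => v i a
    · intro x p hp
      change p ∈ N.val ((Frame.desc (fun J => (c J).frame) (compatible_frame hc)).toFun
        (UProd.mk U k)) (UProd.desc (X := fun i => (M i).W₀) (fun J => (c J).toFun)
          (compatible_toFun hc) x)
      obtain ⟨x, rfl⟩ := h.frame.surj x
      rw [h.val] at hp
      have := (locHom (c ⟨_, hp⟩) fun j => k j).map_val (fun j => x j)
        fun j : {i | p ∈ ((M i).loc (k i)).val (x i)} => j.2
      rw [hk ⟨_, hp⟩]
      exact (congrArg (p ∈ N.val _ ·) (hx ⟨_, hp⟩ x)).mpr this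

noncomputable def filteredProduct (U : Ultrafilter ι) (M : ι → HHModel S) :
    FilteredProduct (U : Filter ι) M :=
  (productSystem (U : Filter ι) M).filteredProduct (ultra U M) (incl M)
    (fun J J' h r hr => Hom.ext
      (Frame.Hom.ext <| funext fun k =>
        UProd.mk_extend (X := fun i => (M i).frame.W) J'.2 _ _ fun j =>
        (congrFun (congrArg (fun f => f.frame.toFun) (hr j)) k).trans
          (UProd.extend_apply (X := fun i => (M i).frame.W) k ⟨j, h j.2⟩).symm)
      (funext fun k => UProd.mk_extend (X := fun i => (M i).W₀) J'.2 _ _ fun j =>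
        (congrFun (congrArg (fun f => f.toFun) (hr j)) k).trans
          (UProd.extend_apply (X := fun i => (M i).W₀) k ⟨j, h j.2⟩).symm))
    desc
    (fun c hc J => Hom.ext
      (Frame.Hom.ext <| funext fun k =>
        UProd.desc_mk_extend (X := fun i => (M i).frame.W) (fun J => (c J).frame.toFun)
          (compatible_frame hc) J k)
      (funext fun k => UProd.desc_mk_extend (X := fun i => (M i).W₀) (fun J => (c J).toFun)
        (compatible_toFun hc) J k))
    (fun d d' h => by
      refine Hom.ext (Frame.Hom.ext (funext fun w => ?_)) (funext fun w => ?_)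
      · obtain ⟨k, rfl⟩ := (isUltra_ultra U M).frame.surj w
        rw [← UProd.mk_extend_univ k]
        exact congrArg (fun f => f.frame.toFun fun j : Set.univ => k j)
          (h ⟨Set.univ, Filter.univ_mem⟩)
      · obtain ⟨k, rfl⟩ := (isUltra_ultra U M).lower.surj w
        rw [← UProd.mk_extend_univ k]
        exact congrArg (fun f => f.toFun fun j : Set.univ => k j)
          (h ⟨Set.univ, Filter.univ_mem⟩))

end HHModel

theorem hhpl_isLos : hhpl.{u}.IsLos where
  iso e w ρ :=
    ((HHForm.sentence_sat_iff_eventually (HHModel.isUltra_of_iso e) ρ fun _ => w).trans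
      Filter.eventually_pure).symm
  nonempty M := M.frame.ne
  neg ρ := ⟨HHForm.neg ρ, fun _ _ => Iff.rfl⟩
  surj _ _ w := ⟨w, rfl⟩
  ultra U M :=
    ⟨HHModel.filteredProduct U M, UProd.mk U, (HHModel.isUltra_ultra U M).frame.surj,
      fun J k' k h => UProd.mk_extend (X := fun i => (M i).frame.W) J.2 k' k h,
      fun _ k => ⟨fun j => k j, fun _ => rfl⟩,
      fun k ρ => HHForm.sentence_sat_iff_eventually (HHModel.isUltra_ultra U M) ρ k⟩

/-! ### From the generic logics to the benchmark list -/

theorem Benchmark.inst_isLos (V : Type u) : ∀ b : Benchmark, (b.inst V).IsLos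
  -- Restricting nominals or modality symbols only restricts the signatures, so these cases come
  -- from the generic logic by `pullback`.
  | MPL | MMPL => (kripkeProp_isLos false).pullback _
  | HPL => (kripkeProp_isLos true).pullback _
  | MHPL => kripkeProp_isLos true
  | MFOL | MMFOL => (kripkeFO_isLos false).pullback _
  | HFOL => (kripkeFO_isLos true).pullback _
  | MHFOL => kripkeFO_isLos true
  | HHPL => hhpl_isLos
  | OFOL => openFO_isLos V false false
  | MOFOL => openFO_isLos V false true
  | HOFOL => openFO_isLos V true false
  | HMOFOL => openFO_isLos V true true

end Strat

theorem mainTheorem1 (V : Type u) (b : Strat.Benchmark) :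
    (b.inst V).HasUltraproducts ∧
    (∀ (S : (b.inst V).Sign) (ρ : (b.inst V).Sen.obj S),
      (b.inst V).PreservedByUltraproducts ρ ∧ (b.inst V).PreservedByUltrafactors ρ) ∧
    (b.inst V).sharp.MCompact ∧
    (∃ h : (b.inst V).StSurjective, ((b.inst V).star h).MCompact) ∧
    (b.inst V).sharp.Compact :=
  have h := b.inst_isLos V
  ⟨h.hasUltraproducts,
    fun _ ρ => ⟨fun _ _ _ A w => (h.sat_iff_factorSat ρ A w).2,
      fun _ _ _ A w => (h.sat_iff_factorSat ρ A w).1⟩,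
    h.sharp_mCompact, ⟨h.surj, h.star_mCompact⟩, h.sharp_compact⟩
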